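/- **Setting.** Let $v_1,v_2,v_3\in\mathbb R^2$ be the vertices of an equilateral triangle, $F_i(x)=\frac12(x+v_i)$, and let $K=\mathcal{SG}$ be the Sierpinski gasket, i.e. the unique nonempty compact set with $K=\bigcup_{i=1}^3F_iK$. For a word $w=w_1\cdots w_m$ over $\{1,2,3\}$ put $F_w=F_{w_1}\circ\cdots\circ F_{w_m}$ and $r_w=r_{w_1}\cdots r_{w_m}$; let $V_0=\{v_1,v_2,v_3\}$. For $c>0$ and $r_1,r_2,r_3\in(0,1)$ with $r_2=r_3$ let $$\mathcal E_0(u)=(u(v_1)-u(v_2))^2+(u(v_1)-u(v_3))^2+c\,(u(v_2)-u(v_3))^2,\qquad \mathcal E_m(u)=\sum_{|w|=m}r_w^{-1}\mathcal E_0(u\circ F_w).$$ We say that $(c,r)$ is a (regular, bilaterally symmetric) harmonic structure if for every $a:V_0\to\mathbb R$ the minimum of $\mathcal E_1(u)$ over all $u$ with $u|_{V_0}=a$ equals $\mathcal E_0(a)$. Put $s=r_2/r_1$. A function on $K$ is harmonic if it is continuous and minimizes $\mathcal E_m$ for every $m\ge 0$ among functions with the same values on $V_0$. More generally, a function on a finite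 union of cells $F_wK$, $w\in A$, is harmonic off a set $S$ if it is continuous and for each $m$ minimizes $\sum_{w\in A}r_w^{-1}\mathcal E_m(u\circ F_w)$ among the functions $u$ with the same values on $S$. Let $M_j$ be the matrix with $h(F_jv_k)=\sum_l(M_j)_{kl}h(v_l)$ for all harmonic $h$ on $K$. Eigendata consist of, for each $j$, linearly independent real left eigenvectors $\beta_{jk}$ ($k=1,2,3$) of $M_j$ with real nonzero eigenvalues $\lambda_{jk}$, $|\lambda_{j1}|\ge|\lambda_{j2}|\ge|\lambda_{j3}|$, and right eigenvectors $\alpha_{jk}$ with $\beta_{jk}\alpha_{jk}=1$; $\beta_{j2}$ is normalized by $(\beta_{j2})_l=-c_{lj}$ for $l\neq j$ and $(\beta_{j2})_j=\sum_{i\ne j}c_{ij}$, where $c_{12}=c_{13}=1$, $c_{23}=c$ and $c_{ij}=c_{ji}$. Let $x=F_2v_3=F_3v_2$ and $U_m(x)=F_2F_3^mK\cup F_3F_2^mK$, whose boundary $\partial U_m(x)$ consists of the four points $F_2F_3^mv_1,F_2F_3^mv_2,F_3F_2^mv_1,F_3F_2^mv_3$. For $k=2,3$, when the limits exist, put $$d_{3k}f(x)=\lim_{m\to\infty}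 r_2^{-1}\lambda_{3k}^{-m}\sum_l(\beta_{3k})_l f(F_2F_3^mv_l),\qquad d_{2k}f(x)=\lim_{m\to\infty} r_3^{-1}\lambda_{2k}^{-m}\sum_l(\beta_{2k})_l f(F_3F_2^mv_l).$$ A function $f$ continuous near $x$ is differentiable at $x$ if all four derivatives exist and $d_{22}f(x)+d_{32}f(x)=0$. A function is called harmonic on $U_0(x)$ if it is harmonic off $\partial U_0(x)$ on $F_2K\cup F_3K$. The weak tangent $T_1^x(f)$ is the function harmonic on $U_0(x)$ having the same value and the same derivatives at $x$ as $f$, and the approximant $h_m$ is the function harmonic on $U_0(x)$ that agrees with $f$ on $\partial U_m(x)$. **Statement.** There is $\varepsilon>0$ such that for each real $s$ with $|s-1|<\varepsilon$ there is a harmonic structure as above with $r_2/r_1=s$, and such that for every harmonic structure as above with $0<|r_2/r_1-1|<\varepsilon$ the following holds. Eigendata exist, and for every choice of eigendata $|\lambda_{23}|=|\lambda_{33}|<\lambda_{22}=\lambda_{32}$. Moreover, for each $\eta$ with $|\lambda_{23}|<\eta<\lambda_{22}$: 1. There is a unique continuous function $f$ on $K$ with $f(F_2F_3^mv_j)=\eta^m(\alpha_{32})_j$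 for $j=1,2$ and $m\ge0$, with $f(v_1)=f(v_3)=f(F_1v_3)=0$ and $f(x)=0$ (the value at $x$ being forced by continuity), and harmonic on $K$ off the set of these points. 2. All the derivatives $d_{22}f(x),d_{23}f(x),d_{32}f(x),d_{33}f(x)$ exist and are $0$; so $f$ is differentiable at $x$, and $T_1^x(f)\equiv0$ on $U_0(x)$ (the zero function is a weak tangent of $f$ at $x$, and the only one). 3. For each $m\ge 0$ the approximant $h_m$ exists and is unique on $U_0(x)$, and $\sup_{U_0(x)}|h_m|\to\infty$ as $m\to\infty$. Hence $h_m$ does not converge to $T_1^x(f)$ on $U_0(x)$, neither uniformly nor even pointwise. In particular it is not true in general that $h_m\to T_1^x(f)$ uniformly on $U_0(x)$ whenever $f$ is differentiable at $x$. -/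

import Mathlib

open Set Filter Topology

noncomputable section

/-- The Euclidean plane. -/
abbrev Plane : Type := EuclideanSpace ℝ (Fin 2)

/-- The three points are the vertices of a (nondegenerate) equilateral triangle. The index
`i : Fin 3` stands for the vertex `v_{i+1}`. -/
def IsEquilateral (v : Fin 3 → Plane) : Prop :=
  ∃ ℓ : ℝ, 0 < ℓ ∧ ∀ i j, i ≠ j → dist (v i) (v j) = ℓ

/-- The similarity `F_i(x) = (x + v_i) / 2`. -/
def sgMap (v : Fin 3 → Plane) (i : Fin 3) (x : Plane) : Plane := (1 / 2 : ℝ) • (x + v i)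

/-- `F_w = F_{w_1} ∘ F_{w_2} ∘ ⋯` for a finite word `w`. -/
def cellMap (v : Fin 3 → Plane) (w : List (Fin 3)) (x : Plane) : Plane := w.foldr (sgMap v) x

/-- The point with address `ω`, i.e. the limit of `F_{ω_0} ∘ ⋯ ∘ F_{ω_n}` applied to any point. -/
def address (v : Fin 3 → Plane) (ω : ℕ → Fin 3) : Plane :=
  ∑' n, (1 / 2 : ℝ) ^ (n + 1) • v (ω n)

/-- The Sierpinski gasket. It is shown below to be the unique nonempty compact set `K` with
`K = F_1 K ∪ F_2 K ∪ F_3 K`. -/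
def gasket (v : Fin 3 → Plane) : Set Plane := range (address v)

lemma address_bound (v : Fin 3 → Plane) (ω : ℕ → Fin 3) (n : ℕ) :
    ‖(1 / 2 : ℝ) ^ (n + 1) • v (ω n)‖ ≤ (1 / 2 : ℝ) ^ n * ∑ i, ‖v i‖ := by
  have h1 : ‖v (ω n)‖ ≤ ∑ i, ‖v i‖ :=
    Finset.single_le_sum (f := fun i => ‖v i‖) (fun i _ => norm_nonneg _) (Finset.mem_univ _)
  have h2 : (0 : ℝ) < (1 / 2 : ℝ) ^ n := by positivity
  rw [norm_smul, Real.norm_of_nonneg (by positivity), pow_succ]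
  nlinarith [norm_nonneg (v (ω n)), mul_le_mul_of_nonneg_left h1 h2.le,
    mul_nonneg h2.le (norm_nonneg (v (ω n)))]

lemma address_bound_summable (v : Fin 3 → Plane) :
    Summable fun n : ℕ => (1 / 2 : ℝ) ^ n * ∑ i, ‖v i‖ :=
  (summable_geometric_of_lt_one (by norm_num) (by norm_num)).mul_right _

lemma address_summable (v : Fin 3 → Plane) (ω : ℕ → Fin 3) :
    Summable fun n : ℕ => (1 / 2 : ℝ) ^ (n + 1) • v (ω n) :=
  Summable.of_norm_bounded (address_bound_summable v) (address_bound v ω)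

lemma address_continuous (v : Fin 3 → Plane) : Continuous (address v) := by
  refine continuous_tsum (fun n => ?_) (address_bound_summable v)
    (fun n ω => address_bound v ω n)
  have h : Continuous fun ω : ℕ → Fin 3 => v (ω n) :=
    (continuous_of_discreteTopology (f := v)).comp (continuous_apply (A := fun _ => Fin 3) n)
  exact h.const_smul ((1 / 2 : ℝ) ^ (n + 1))

lemma address_eq (v : Fin 3 → Plane) (ω : ℕ → Fin 3) :
    address v ω = sgMap v (ω 0) (address v fun n => ω (n + 1)) := by
  have h := (address_summable v ω).tsum_eq_zero_add
  unfold address sgMap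
  rw [h, smul_add, ← tsum_const_smul'' (1 / 2 : ℝ), add_comm]
  simp [pow_succ, mul_comm, smul_smul]

/-- The gasket is a nonempty compact set, invariant under the iterated function system. -/
theorem gasket_spec (v : Fin 3 → Plane) :
    (gasket v).Nonempty ∧ IsCompact (gasket v) ∧ gasket v = ⋃ i, sgMap v i '' gasket v := by
  refine ⟨range_nonempty _, isCompact_range (address_continuous v), ?_⟩
  ext x
  simp only [mem_iUnion, mem_image]
  constructor
  · rintro ⟨ω, rfl⟩
    exact ⟨ω 0, _, ⟨_, rfl⟩, (address_eq v ω).symm⟩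
  · rintro ⟨i, _, ⟨ω, rfl⟩, rfl⟩
    exact ⟨fun n => Nat.casesOn n i ω, address_eq v _⟩

/-- The gasket is the only such set. -/
theorem gasket_unique (v : Fin 3 → Plane) (K : Set Plane) (hne : K.Nonempty) (hK : IsCompact K)
    (hinv : K = ⋃ i, sgMap v i '' K) : K = gasket v := by
  obtain ⟨R, hR⟩ := (hK.isBounded.union (gasket_spec v).2.1.isBounded).exists_norm_le
  have hmaps : ∀ i, ∀ y ∈ K, sgMap v i y ∈ K := fun i y hy => by
    rw [hinv]; exact mem_iUnion.2 ⟨i, y, hy, rfl⟩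
  have hdist : ∀ i x y, dist (sgMap v i x) (sgMap v i y) = (1 / 2 : ℝ) * dist x y := by
    intro i x y
    simp [sgMap, dist_smul₀, dist_add_right]
  have key : ∀ n (ω : ℕ → Fin 3) (x : ℕ → Plane), (∀ n, x n ∈ K) →
      (∀ n, x n = sgMap v (ω n) (x (n + 1))) →
      dist (x 0) (address v ω) ≤ (1 / 2 : ℝ) ^ n * (2 * R) := by
    intro n
    induction n with
    | zero =>
      intro ω x hx _
      have h1 := hR _ (Or.inl (hx 0))
      have h2 := hR (address v ω) (Or.inr ⟨ω, rfl⟩)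
      have := dist_le_norm_add_norm (x 0) (address v ω)
      simp only [pow_zero, one_mul]; linarith
    | succ n ih =>
      intro ω x hx hs
      rw [hs 0, address_eq v ω, hdist]
      have := ih (fun n => ω (n + 1)) (fun n => x (n + 1)) (fun n => hx _) (fun n => hs _)
      rw [pow_succ]; linarith
  have key2 : ∀ n (ω : ℕ → Fin 3), ∃ y ∈ K, dist y (address v ω) ≤ (1 / 2 : ℝ) ^ n * (2 * R) := by
    intro n
    induction n with
    | zero =>
      intro ω
      obtain ⟨y, hy⟩ := hne
      refine ⟨y, hy, ?_⟩
      have h1 := hR _ (Or.inl hy)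
      have h2 := hR (address v ω) (Or.inr ⟨ω, rfl⟩)
      have := dist_le_norm_add_norm y (address v ω)
      simp only [pow_zero, one_mul]; linarith
    | succ n ih =>
      intro ω
      obtain ⟨y, hy, hd⟩ := ih (fun n => ω (n + 1))
      refine ⟨_, hmaps (ω 0) y hy, ?_⟩
      rw [address_eq v ω, hdist, pow_succ]; linarith
  have hlim : Tendsto (fun n : ℕ => (1 / 2 : ℝ) ^ n * (2 * R)) atTop (𝓝 0) := by
    simpa using (tendsto_pow_atTop_nhds_zero_of_lt_one (r := (1 / 2 : ℝ)) (by norm_num)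
      (by norm_num)).mul_const (2 * R)
  apply Subset.antisymm
  · intro x hx
    have hstep : ∀ y : K, ∃ (i : Fin 3) (z : K), (y : Plane) = sgMap v i z := by
      rintro ⟨y, hy⟩
      rw [hinv] at hy
      obtain ⟨i, z, hz, rfl⟩ := mem_iUnion.1 hy
      exact ⟨i, ⟨z, hz⟩, rfl⟩
    choose I Z hIZ using hstep
    let xs : ℕ → K := fun n => Z^[n] ⟨x, hx⟩
    have hs : ∀ n, ((xs n : K) : Plane) = sgMap v (I (xs n)) (xs (n + 1)) := fun n => by
      simp only [xs, Function.iterate_succ_apply']; exact hIZ _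
    refine ⟨fun n => I (xs n), ?_⟩
    have := ge_of_tendsto' hlim fun n =>
      key n (fun n => I (xs n)) (fun n => xs n) (fun n => (xs n).2) hs
    exact (dist_le_zero.1 this).symm
  · rintro _ ⟨ω, rfl⟩
    rw [← hK.isClosed.closure_eq, Metric.mem_closure_iff]
    intro ε hε
    obtain ⟨n, hn⟩ := (hlim.eventually (gt_mem_nhds hε)).exists
    obtain ⟨y, hy, hd⟩ := key2 n ω
    exact ⟨y, hy, by rw [dist_comm]; linarith⟩

/-- The conductances `c_{12} = c_{13} = 1`, `c_{23} = c`. -/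
def conductance (c : ℝ) (i j : Fin 3) : ℝ :=
  if i = j then 0 else if i = 0 ∨ j = 0 then 1 else c

/-- The energy `𝓔_0` of a function on the three boundary vertices. -/
def baseEnergy (c : ℝ) (a : Fin 3 → ℝ) : ℝ :=
  (a 0 - a 1) ^ 2 + (a 0 - a 2) ^ 2 + c * (a 1 - a 2) ^ 2

/-- `r_w = r_{w_1} ⋯ r_{w_m}`. -/
def cellRatio (r : Fin 3 → ℝ) (w : List (Fin 3)) : ℝ := (w.map r).prod

/-- The level `m` energy `𝓔_m(u) = ∑_{|w| = m} r_w⁻¹ 𝓔_0(u ∘ F_w)`. -/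
def energy (v : Fin 3 → Plane) (c : ℝ) (r : Fin 3 → ℝ) (m : ℕ) (u : Plane → ℝ) : ℝ :=
  ∑ w : Fin m → Fin 3, (cellRatio r (List.ofFn w))⁻¹ *
    baseEnergy c fun i => u (cellMap v (List.ofFn w) (v i))

/-- A regular harmonic structure on the gasket with a bilateral symmetry exchanging `v_2` and
`v_3`: positive conductances, factors in `(0,1)` with `r_2 = r_3`, and the renormalization
equation saying that `𝓔_0` is the trace of `𝓔_1` on the boundary. -/
structure IsBilateralStructure (v : Fin 3 → Plane) (c : ℝ) (r : Fin 3 → ℝ) : Prop where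
  c_pos : 0 < c
  r_pos : ∀ i, 0 < r i
  r_lt_one : ∀ i, r i < 1
  r_symm : r 1 = r 2
  renorm : ∀ a : Fin 3 → ℝ,
    IsLeast {e | ∃ u : Plane → ℝ, (∀ i, u (v i) = a i) ∧ e = energy v c r 1 u} (baseEnergy c a)

/-- The union of the cells `F_w K`, `w ∈ A`. -/
def cellUnion (v : Fin 3 → Plane) (A : Finset (List (Fin 3))) : Set Plane :=
  ⋃ w ∈ A, cellMap v w '' gasket v

/-- The level `m` energy restricted to the cells `F_w K`, `w ∈ A`:
`∑_{w ∈ A} r_w⁻¹ 𝓔_m(u ∘ F_w)`. -/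
def localEnergy (v : Fin 3 → Plane) (c : ℝ) (r : Fin 3 → ℝ) (A : Finset (List (Fin 3))) (m : ℕ)
    (u : Plane → ℝ) : ℝ :=
  ∑ w ∈ A, (cellRatio r w)⁻¹ * energy v c r m fun x => u (cellMap v w x)

/-- `h` is the harmonic extension to the union of the cells `F_w K`, `w ∈ A`, of its values on
`S`: it is continuous and minimizes the energies of all levels for its given values on `S`.
Only the values of `h` on the union of the cells matter. -/
def IsHarmonicOn (v : Fin 3 → Plane) (c : ℝ) (r : Fin 3 → ℝ) (A : Finset (List (Fin 3)))
    (S : Set Plane) (h : Plane → ℝ) : Prop :=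
  ContinuousOn h (cellUnion v A) ∧
    ∀ (m : ℕ) (u : Plane → ℝ), EqOn u h S → localEnergy v c r A m h ≤ localEnergy v c r A m u

/-- The harmonic functions on the whole gasket `K`, with boundary `V_0 = {v_1, v_2, v_3}`. -/
def IsHarmonic (v : Fin 3 → Plane) (c : ℝ) (r : Fin 3 → ℝ) (h : Plane → ℝ) : Prop :=
  IsHarmonicOn v c r {[]} (range v) h

/-- The transition matrices `M_j` together with a complete set of real left eigenvectors
`β_{jk}` with nonzero real eigenvalues `λ_{jk}` in decreasing order of absolute value, and right
eigenvectors `α_{jk}` with `β_{jk} α_{jk} = 1`. The index `k : Fin 3` stands for the number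
`k + 1`. The eigenvectors `β_{j2}` are normalized so as to give normal derivatives. -/
structure IsEigenData (v : Fin 3 → Plane) (c : ℝ) (r : Fin 3 → ℝ)
    (M : Fin 3 → Matrix (Fin 3) (Fin 3) ℝ) (lam : Fin 3 → Fin 3 → ℝ)
    (β α : Fin 3 → Fin 3 → Fin 3 → ℝ) : Prop where
  transition : ∀ h, IsHarmonic v c r h →
    ∀ j k, h (sgMap v j (v k)) = ∑ l, M j k l * h (v l)
  left_eigen : ∀ j k, Matrix.vecMul (β j k) (M j) = lam j k • β j k
  complete : ∀ j, LinearIndependent ℝ (β j)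
  lam_ne_zero : ∀ j k, lam j k ≠ 0
  ordered : ∀ j, Antitone fun k => |lam j k|
  right_eigen : ∀ j k, (M j).mulVec (α j k) = lam j k • α j k
  pairing : ∀ j k, β j k ⬝ᵥ α j k = 1
  normal : ∀ j l, β j 1 l = if l = j then ∑ i, conductance c i j else -conductance c l j

/-- `d_{jk} f(x) = d` at the vertex `x = F_w v_j` from inside the cell `F_w K`:
`d = lim_m r_w⁻¹ λ_{jk}^{-m} β_{jk} f|_{F_w F_j^m V_0}`. -/
def HasVertexDeriv (v : Fin 3 → Plane) (r : Fin 3 → ℝ) (lam : Fin 3 → Fin 3 → ℝ)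
    (β : Fin 3 → Fin 3 → Fin 3 → ℝ) (f : Plane → ℝ) (w : List (Fin 3)) (j k : Fin 3) (d : ℝ) :
    Prop :=
  Tendsto (fun m : ℕ => (cellRatio r w)⁻¹ * (lam j k ^ m)⁻¹ *
    ∑ l, β j k l * f (cellMap v (w ++ List.replicate m j) (v l))) atTop (𝓝 d)

/-- The words of the two cells forming the standard neighborhood `U_m(x)` of the junction vertex
`x = F_w F_i v_j = F_w F_j v_i`, where `i ≠ j`. -/
def nbhdCells (w : List (Fin 3)) (i j : Fin 3) (m : ℕ) : Finset (List (Fin 3)) :=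
  {w ++ i :: List.replicate m j, w ++ j :: List.replicate m i}

/-- `U_m(x) = F_w F_i F_j^m K ∪ F_w F_j F_i^m K` for `x = F_w F_i v_j = F_w F_j v_i`. -/
def nbhd (v : Fin 3 → Plane) (w : List (Fin 3)) (i j : Fin 3) (m : ℕ) : Set Plane :=
  cellUnion v (nbhdCells w i j m)

/-- The four boundary points of `U_m(x)`, for `x = F_w F_i v_j = F_w F_j v_i`. -/
def nbhdBoundary (v : Fin 3 → Plane) (w : List (Fin 3)) (i j : Fin 3) (m : ℕ) : Set Plane :=
  {p | (∃ l, l ≠ j ∧ p = cellMap v (w ++ i :: List.replicate m j) (v l)) ∨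
    ∃ l, l ≠ i ∧ p = cellMap v (w ++ j :: List.replicate m i) (v l)}

/-- Differentiability at the junction vertex `x = F_w F_i v_j = F_w F_j v_i`: all derivatives
exist on both sides and the two normal derivatives add up to zero. -/
def IsDifferentiableAtJunction (v : Fin 3 → Plane) (r : Fin 3 → ℝ) (lam : Fin 3 → Fin 3 → ℝ)
    (β : Fin 3 → Fin 3 → Fin 3 → ℝ) (f : Plane → ℝ) (w : List (Fin 3)) (i j : Fin 3) : Prop :=
  (∃ m, ContinuousOn f (nbhd v w i j m)) ∧ ∃ d e : Fin 3 → ℝ,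
    (∀ k, k ≠ 0 → HasVertexDeriv v r lam β f (w ++ [i]) j k (d k)) ∧
    (∀ k, k ≠ 0 → HasVertexDeriv v r lam β f (w ++ [j]) i k (e k)) ∧
    d 1 + e 1 = 0

/-- `T` is a weak tangent of order one of `f` at the junction vertex
`x = F_w F_i v_j = F_w F_j v_i`: it is harmonic on `U_0(x)` and has the same value and the same
derivatives at `x` as `f`. -/
def IsWeakTangent (v : Fin 3 → Plane) (c : ℝ) (r : Fin 3 → ℝ) (lam : Fin 3 → Fin 3 → ℝ)
    (β : Fin 3 → Fin 3 → Fin 3 → ℝ) (f : Plane → ℝ) (w : List (Fin 3)) (i j : Fin 3)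
    (T : Plane → ℝ) : Prop :=
  IsHarmonicOn v c r (nbhdCells w i j 0) (nbhdBoundary v w i j 0) T ∧
  T (cellMap v (w ++ [i]) (v j)) = f (cellMap v (w ++ [i]) (v j)) ∧
  ∀ k, k ≠ 0 →
    (∃ d, HasVertexDeriv v r lam β f (w ++ [i]) j k d ∧
      HasVertexDeriv v r lam β T (w ++ [i]) j k d) ∧
    (∃ d, HasVertexDeriv v r lam β f (w ++ [j]) i k d ∧
      HasVertexDeriv v r lam β T (w ++ [j]) i k d)

/-- `h` is the approximant `h_m` of `f` at the junction vertex `x = F_w F_i v_j = F_w F_j v_i`: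
it is harmonic on `U_0(x)` and agrees with `f` on the boundary of `U_m(x)`. -/
def IsApproximant (v : Fin 3 → Plane) (c : ℝ) (r : Fin 3 → ℝ) (f : Plane → ℝ)
    (w : List (Fin 3)) (i j : Fin 3) (m : ℕ) (h : Plane → ℝ) : Prop :=
  IsHarmonicOn v c r (nbhdCells w i j 0) (nbhdBoundary v w i j 0) h ∧
    EqOn h f (nbhdBoundary v w i j m)

/-- The points `F_2 F_3^m v_1`, `F_2 F_3^m v_2` (`m ≥ 0`), `v_1`, `v_3`, `F_1 v_3`, and their only
accumulation point `F_2 v_3`. -/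
def exampleNodes (v : Fin 3 → Plane) : Set Plane :=
  {p | ∃ (m : ℕ) (j : Fin 3), j ≠ 2 ∧ p = cellMap v (1 :: List.replicate m 2) (v j)} ∪
    {v 0, v 2, cellMap v [0] (v 2), cellMap v [1] (v 2)}

/-- The continuous function on the gasket with `f(F_2 F_3^m v_j) = η^m (α_{32})_j` for
`j = 1, 2`, `m ≥ 0`, with the value `0` at `v_1`, `v_3`, `F_1 v_3` (and, by continuity, at
`F_2 v_3`), extended harmonically to all other points. -/
structure IsExampleFunction (v : Fin 3 → Plane) (c : ℝ) (r : Fin 3 → ℝ)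
    (α : Fin 3 → Fin 3 → Fin 3 → ℝ) (η : ℝ) (f : Plane → ℝ) : Prop where
  value : ∀ (m : ℕ) (j : Fin 3), j ≠ 2 →
    f (cellMap v (1 :: List.replicate m 2) (v j)) = η ^ m * α 2 1 j
  value_v1 : f (v 0) = 0
  value_v3 : f (v 2) = 0
  value_F1v3 : f (cellMap v [0] (v 2)) = 0
  value_F2v3 : f (cellMap v [1] (v 2)) = 0
  harmonic : IsHarmonicOn v c r {[]} (exampleNodes v) f

end

/-! At `v_2` and `v_3` the transition matrix has eigenvalues `1`, `r_2` and `μ = (1 - r_2) / 2`. The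
right eigenvectors are the constant, a normal vector `(g, d)` and a tangential vector `(-c, 1)`, the
entries being those at `v_1` and at the other symmetric vertex. A function harmonic on `U_0(x)` is
therefore given by its value `ξ` at `x`, normal coefficients `P` and `-P` on the two cells (fluxes
balance at `x`), and independent tangential coefficients `Q`, `Q'`: four parameters for four
boundary values (`IsHarmonicOn.nbhd_eigenComb`).

On the boundary of `F_2 F_3^m K` the example `f` is `η^m` times the normal eigenvector, and on `F_3
K` it vanishes. Its normal derivative at `x` is a limit of multiples of `(η / r_2)^m`, hence zero,
and its tangential derivatives vanish exactly, by biorthogonality. So the weak tangent is zero.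

The approximant has to fit normal data `κ (g, d)`, with `κ` proportional to `η^m`, on one side only.
Half of it, taken antisymmetrically, is an admissible normal part. The other half, `κ/2 (g, d)` on
both sides, can only be written as `ξ (1, 1) + q (-c, 1)`, which forces `q = (κ/2) (d - g) / (1 +
c)`. Passing from `U_m(x)` back to `U_0(x)` divides `q` by `μ^m`, so the tangential coefficient has
order `(η / μ)^m` and blows up, provided `g ≠ d`. By `IsRenormParam.g_ne_d`, equality would force `c
= 1` and `r_1 = r_2`.

Supporting this are three facts: compatible vertex values with geometrically decaying oscillation
extend continuously (`IsVertexData.exists_continuousOn`); completing squares turns the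
renormalization condition into two equations (`isLeast_energy_one`); and the parallelogram law makes
energy minimizers unique (`eq_of_isHarmonicOn`). The example is built self-similarly on `F_2 K`,
where its part on `F_2 F_3 K` is `η` times a copy of the whole. -/

/-! ### Cell maps, addresses and density of the vertices -/

lemma sgMap_self (v : Fin 3 → Plane) (i : Fin 3) : sgMap v i (v i) = v i := by
  rw [sgMap, ← two_smul ℝ (v i), smul_smul]; norm_num

lemma sgMap_comm (v : Fin 3 → Plane) (i j : Fin 3) : sgMap v i (v j) = sgMap v j (v i) := by
  rw [sgMap, sgMap, add_comm]

lemma sgMap_injective (v : Fin 3 → Plane) (i : Fin 3) : Function.Injective (sgMap v i) := by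
  intro x y h
  have h' := smul_right_injective Plane (by norm_num : (1 / 2 : ℝ) ≠ 0) h
  simpa using h'

lemma continuous_sgMap (v : Fin 3 → Plane) (i : Fin 3) : Continuous (sgMap v i) := by
  unfold sgMap; fun_prop

@[simp] lemma cellMap_nil (v : Fin 3 → Plane) (x : Plane) : cellMap v [] x = x := rfl

lemma cellMap_cons (v : Fin 3 → Plane) (i : Fin 3) (w : List (Fin 3)) (x : Plane) :
    cellMap v (i :: w) x = sgMap v i (cellMap v w x) := rfl

lemma cellMap_append (v : Fin 3 → Plane) (w w' : List (Fin 3)) (x : Plane) :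
    cellMap v (w ++ w') x = cellMap v w (cellMap v w' x) := by
  simp [cellMap, List.foldr_append]

lemma continuous_cellMap (v : Fin 3 → Plane) (w : List (Fin 3)) : Continuous (cellMap v w) := by
  induction w with
  | nil => exact continuous_id
  | cons i w ih => exact (continuous_sgMap v i).comp ih

lemma cellMap_replicate_self (v : Fin 3 → Plane) (i : Fin 3) (m : ℕ) :
    cellMap v (List.replicate m i) (v i) = v i := by
  induction m with
  | zero => rfl
  | succ m ih => rw [List.replicate_succ, cellMap_cons, ih, sgMap_self]

lemma address_cons (v : Fin 3 → Plane) (i : Fin 3) (ω : ℕ → Fin 3) :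
    address v (fun n => Nat.casesOn n i ω) = sgMap v i (address v ω) := address_eq v _

lemma sgMap_mem_gasket (v : Fin 3 → Plane) (i : Fin 3) {x : Plane} (hx : x ∈ gasket v) :
    sgMap v i x ∈ gasket v := by
  obtain ⟨ω, rfl⟩ := hx
  exact ⟨_, address_cons v i ω⟩

lemma cellMap_mem_gasket (v : Fin 3 → Plane) (w : List (Fin 3)) {x : Plane} (hx : x ∈ gasket v) :
    cellMap v w x ∈ gasket v := by
  induction w with
  | nil => exact hx
  | cons i w ih => exact sgMap_mem_gasket v i ih

lemma address_const (v : Fin 3 → Plane) (i : Fin 3) : address v (fun _ => i) = v i := by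
  have h := address_eq v (fun _ => i)
  have h2 : (2 : ℝ) • address v (fun _ => i) = address v (fun _ => i) + v i := by
    conv_lhs => rw [h]
    rw [sgMap, smul_smul]; norm_num
  rw [two_smul] at h2
  exact add_left_cancel h2

lemma vertex_mem_gasket (v : Fin 3 → Plane) (i : Fin 3) : v i ∈ gasket v :=
  ⟨_, address_const v i⟩

lemma address_truncate (v : Fin 3 → Plane) (i : Fin 3) (n : ℕ) (ω : ℕ → Fin 3) :
    address v (fun k => if k < n then ω k else i) = cellMap v ((List.range n).map ω) (v i) := by
  induction n generalizing ω with
  | zero => simp [address_const]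
  | succ n ih =>
    rw [address_eq, List.range_succ_eq_map, List.map_cons, cellMap_cons, List.map_map]
    have := ih (fun k => ω (k + 1))
    simp only [Nat.add_lt_add_iff_right, Nat.zero_lt_succ, if_true]
    rw [this]; rfl

lemma tendsto_truncate (i : Fin 3) (ω : ℕ → Fin 3) :
    Tendsto (fun n k => if k < n then ω k else i) atTop (𝓝 ω) := by
  rw [tendsto_pi_nhds]
  intro k
  refine tendsto_const_nhds.congr' ?_
  filter_upwards [eventually_gt_atTop k] with n hn
  rw [if_pos hn]

/-- Continuous functions on a union of cells that agree at all vertices agree everywhere. -/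
lemma eqOn_cellUnion {v : Fin 3 → Plane} {A : Finset (List (Fin 3))} {f g : Plane → ℝ}
    (hf : ContinuousOn f (cellUnion v A)) (hg : ContinuousOn g (cellUnion v A))
    (h : ∀ w ∈ A, ∀ w' i, f (cellMap v (w ++ w') (v i)) = g (cellMap v (w ++ w') (v i))) :
    EqOn f g (cellUnion v A) := by
  intro p hp
  obtain ⟨w, hw, _, ⟨ω, rfl⟩, rfl⟩ : ∃ w, ∃ _ : w ∈ A, p ∈ cellMap v w '' gasket v := by
    simpa [cellUnion] using hp
  have hc : ∀ {u : Plane → ℝ}, ContinuousOn u (cellUnion v A) →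
      Continuous fun ω => u (cellMap v w (address v ω)) := by
    intro u hu
    refine hu.comp_continuous ((continuous_cellMap v w).comp (address_continuous v)) fun ω => ?_
    exact mem_biUnion (show w ∈ (A : Set (List (Fin 3))) from hw) ⟨_, ⟨ω, rfl⟩, rfl⟩
  have h1 := ((hc hf).tendsto ω).comp (tendsto_truncate 0 ω)
  have h2 := ((hc hg).tendsto ω).comp (tendsto_truncate 0 ω)
  refine tendsto_nhds_unique h1 (h2.congr fun n => ?_)
  simp only [Function.comp, address_truncate, ← cellMap_append]
  exact (h w hw _ _).symm

/-- Barycentric coordinates with respect to the three vertices. -/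
structure IsBarycentric (v : Fin 3 → Plane) (φ : Fin 3 → Plane → ℝ) : Prop where
  continuous : ∀ i, Continuous (φ i)
  vertex : ∀ i j, φ i (v j) = if i = j then 1 else 0
  map : ∀ i j x, φ i (sgMap v j x) = (φ i x + if i = j then 1 else 0) / 2

lemma IsEquilateral.exists_barycentric {v : Fin 3 → Plane} (hv : IsEquilateral v) :
    ∃ φ, IsBarycentric v φ := by
  obtain ⟨ℓ, hℓ, hd⟩ := hv
  set a := v 1 - v 0 with ha
  set b := v 2 - v 0 with hb
  have haa : inner ℝ a a = ℓ ^ 2 := by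
    rw [real_inner_self_eq_norm_sq, ha, ← dist_eq_norm, hd 1 0 (by decide)]
  have hbb : inner ℝ b b = ℓ ^ 2 := by
    rw [real_inner_self_eq_norm_sq, hb, ← dist_eq_norm, hd 2 0 (by decide)]
  have hab : inner ℝ a b = ℓ ^ 2 / 2 := by
    have h : ‖a - b‖ = ℓ := by
      rw [ha, hb, sub_sub_sub_cancel_right, ← dist_eq_norm, hd 1 2 (by decide)]
    have h2 := norm_sub_sq_real a b
    rw [h, ← real_inner_self_eq_norm_sq, ← real_inner_self_eq_norm_sq, haa, hbb] at h2
    linarith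
  have hba : inner ℝ b a = ℓ ^ 2 / 2 := by rw [real_inner_comm]; exact hab
  have hℓ2 : ℓ ^ 2 ≠ 0 := by positivity
  let ψ : Plane → Plane → ℝ := fun y x => inner ℝ y (x - v 0) / ℓ ^ 2
  -- Up to the factor `ℓ ^ 2`, the basis dual to `a`, `b`: the Gram matrix is `ℓ ^ 2` times `(1,
  -- 1/2; 1/2, 1)`, whose inverse has entries `4/3` and `-2/3`.
  let y1 := (4 / 3 : ℝ) • a - (2 / 3 : ℝ) • b
  let y2 := (4 / 3 : ℝ) • b - (2 / 3 : ℝ) • a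
  have hψc : ∀ y, Continuous (ψ y) := fun y => by
    exact (Continuous.inner (𝕜 := ℝ) continuous_const (continuous_id.sub continuous_const)).div_const _
  have hψm : ∀ y j x, ψ y (sgMap v j x) = (ψ y x + ψ y (v j)) / 2 := by
    intro y j x
    have : sgMap v j x - v 0 = (1 / 2 : ℝ) • ((x - v 0) + (v j - v 0)) := by
      rw [sgMap]; module
    simp only [ψ, this, inner_smul_right, inner_add_right]
    ring
  have h1 : ψ y1 (v 0) = 0 ∧ ψ y1 (v 1) = 1 ∧ ψ y1 (v 2) = 0 := by
    simp only [ψ, y1, ← ha, ← hb, sub_self, inner_zero_right, inner_sub_left, real_inner_smul_left,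
      haa, hba, hab, hbb]
    refine ⟨by simp, by field_simp; norm_num, by field_simp; norm_num⟩
  have h2 : ψ y2 (v 0) = 0 ∧ ψ y2 (v 1) = 0 ∧ ψ y2 (v 2) = 1 := by
    simp only [ψ, y2, ← ha, ← hb, sub_self, inner_zero_right, inner_sub_left, real_inner_smul_left,
      haa, hba, hab, hbb]
    refine ⟨by simp, by field_simp; norm_num, by field_simp; norm_num⟩
  obtain ⟨h10, h11, h12⟩ := h1
  obtain ⟨h20, h21, h22⟩ := h2
  refine ⟨![fun x => 1 - ψ y1 x - ψ y2 x, ψ y1, ψ y2], ?_, ?_, ?_⟩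
  · have := hψc y1
    have := hψc y2
    intro i; fin_cases i <;> simp <;> fun_prop
  · intro i j
    fin_cases i <;> fin_cases j <;> simp [h10, h11, h12, h20, h21, h22]
  · intro i j x
    fin_cases i <;> fin_cases j <;> simp [hψm, h10, h11, h12, h20, h21, h22] <;> ring

/-! ### Barycentric coordinates and points with two addresses -/

section Barycentric

variable {v : Fin 3 → Plane} {φ : Fin 3 → Plane → ℝ}

/-- Extreme values are attained by compactness. An extremal point lies in some cell, so its
coordinate is half that of another point of the gasket plus `0` or `1/2`; comparing the two bounds
the extremum. -/
lemma IsBarycentric.mem_Icc (h : IsBarycentric v φ) (i : Fin 3) {p : Plane} (hp : p ∈ gasket v) :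
    0 ≤ φ i p ∧ φ i p ≤ 1 := by
  obtain ⟨hne, hc, hinv⟩ := gasket_spec v
  have hstep : ∀ x ∈ gasket v, ∃ j, ∃ y ∈ gasket v, x = sgMap v j y := by
    intro x hx
    rw [hinv] at hx
    obtain ⟨j, y, hy, rfl⟩ := mem_iUnion.1 hx
    exact ⟨j, y, hy, rfl⟩
  obtain ⟨x, hx, hxm⟩ := hc.exists_isMinOn hne (h.continuous i).continuousOn
  obtain ⟨y, hy, hym⟩ := hc.exists_isMaxOn hne (h.continuous i).continuousOn
  constructor
  · obtain ⟨j, z, hz, hxz⟩ := hstep x hx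
    have e := h.map i j z
    rw [← hxz] at e
    have := hxm hz
    have := hxm hp
    simp only [mem_ofPred_eq] at *
    split_ifs at e <;> linarith
  · obtain ⟨j, z, hz, hxz⟩ := hstep y hy
    have e := h.map i j z
    rw [← hxz] at e
    have := hym hz
    have := hym hp
    simp only [mem_ofPred_eq] at *
    split_ifs at e <;> linarith

/-- A first letter other than `i` would keep the coordinate at most `1/2`. A first letter `i` forces
the shifted address to have coordinate at least `1` again. -/
lemma IsBarycentric.eq_const (h : IsBarycentric v φ) (i : Fin 3) (n : ℕ) (ω : ℕ → Fin 3)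
    (hω : 1 ≤ φ i (address v ω)) : ω n = i := by
  have e := h.map i (ω 0) (address v fun n => ω (n + 1))
  rw [← address_eq] at e
  have h1 := (h.mem_Icc i ⟨fun n => ω (n + 1), rfl⟩).2
  induction n generalizing ω with
  | zero => split_ifs at e with h0
            · exact h0.symm
            · linarith
  | succ n ih =>
    refine ih (fun n => ω (n + 1)) ?_ ?_ (h.mem_Icc i ⟨_, rfl⟩).2
    · split_ifs at e <;> linarith
    · have e := h.map i (ω 1) (address v fun n => ω (n + 2))
      rw [← address_eq v fun n => ω (n + 1)] at e
      exact e

/-- Two different addresses of the same point are of the form `w i j j j …` and `w j i i i …`. -/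
lemma IsBarycentric.address_eq_address (h : IsBarycentric v φ) {ω ω' : ℕ → Fin 3}
    (heq : address v ω = address v ω') (hne : ω ≠ ω') :
    ∃ n, (∀ k < n, ω k = ω' k) ∧ (∀ k, ω (n + 1 + k) = ω' n) ∧ ∀ k, ω' (n + 1 + k) = ω n := by
  classical
  have hex : ∃ n, ω n ≠ ω' n := Function.ne_iff.1 hne
  have hmin : ∀ k < Nat.find hex, ω k = ω' k := fun k hk => not_not.1 (Nat.find_min hex hk)
  have hn := Nat.find_spec hex
  set n := Nat.find hex
  have htail : ∀ k ≤ n, address v (fun l => ω (k + l)) = address v (fun l => ω' (k + l)) := by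
    intro k
    induction k with
    | zero => intro _; simpa using heq
    | succ k ih =>
      intro hk
      have e := ih (by omega)
      rw [address_eq, address_eq v fun l => ω' (k + l)] at e
      simp only [add_zero, hmin k (by omega)] at e
      have := sgMap_injective v _ e
      simpa only [add_assoc, add_comm 1] using this
  -- The coordinate of index `σ' 0` at the common point is at most `1/2` seen from `σ` and at least
  -- `1/2` seen from `σ'`. Equality puts the tail of `σ` at the vertex `v (σ' 0)`.
  have key : ∀ σ σ' : ℕ → Fin 3, address v σ = address v σ' → σ 0 ≠ σ' 0 →
      ∀ k, σ (k + 1) = σ' 0 := by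
    intro σ σ' e hσ k
    refine h.eq_const (σ' 0) k (fun n => σ (n + 1)) ?_
    have e1 := h.map (σ' 0) (σ 0) (address v fun n => σ (n + 1))
    have e2 := h.map (σ' 0) (σ' 0) (address v fun n => σ' (n + 1))
    rw [← address_eq, e] at e1
    rw [← address_eq] at e2
    rw [if_neg hσ.symm] at e1
    rw [if_pos rfl] at e2
    have := (h.mem_Icc (σ' 0) ⟨fun n => σ' (n + 1), rfl⟩).1
    linarith
  have e := htail n le_rfl
  refine ⟨n, hmin, fun k => ?_, fun k => ?_⟩
  · have := key _ _ e hn k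
    simpa only [add_assoc, add_comm 1, add_zero] using this
  · have := key _ _ e.symm hn.symm k
    simpa only [add_assoc, add_comm 1, add_zero] using this

end Barycentric

/-- Compatible values `a w i` at the vertices `F_w v_i` that define a continuous function. -/
structure IsVertexData (a : List (Fin 3) → Fin 3 → ℝ) : Prop where
  corner : ∀ w j, a (w ++ [j]) j = a w j
  junction : ∀ w i j, a (w ++ [i]) j = a (w ++ [j]) i
  oscillation : ∃ C θ : ℝ, 0 ≤ C ∧ 0 < θ ∧ θ < 1 ∧
    ∀ w w' i j, |a (w ++ w') i - a w j| ≤ C * θ ^ w.length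

/-! ### Continuous functions from values at the vertices -/

section VertexData

variable {a : List (Fin 3) → Fin 3 → ℝ}

lemma IsVertexData.replicate (h : IsVertexData a) (w : List (Fin 3)) (j : Fin 3) (m : ℕ) :
    a (w ++ List.replicate m j) j = a w j := by
  induction m with
  | zero => simp
  | succ m ih => rw [List.replicate_succ', ← List.append_assoc, h.corner, ih]

lemma range_map_add (ω : ℕ → Fin 3) (n m : ℕ) :
    (List.range (n + m)).map ω =
      (List.range n).map ω ++ (List.range m).map fun k => ω (n + k) := by
  rw [List.range_add, List.map_append, List.map_map]; rfl

lemma range_map_const (j : Fin 3) (m : ℕ) :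
    (List.range m).map (fun _ => j) = List.replicate m j := by
  simp [List.map_const']

/-- The values along truncated addresses are Cauchy at a geometric rate that does not depend on the
address, and each truncated value depends on finitely many letters only; so the limit is a uniform
limit of continuous functions. -/
lemma IsVertexData.exists_limit (h : IsVertexData a) : ∃ H : (ℕ → Fin 3) → ℝ, Continuous H ∧
    ∀ ω i, Tendsto (fun n => a ((List.range n).map ω) i) atTop (𝓝 (H ω)) := by
  obtain ⟨C, θ, -, hθ0, hθ1, hosc⟩ := h.oscillation
  let ρ : ℕ → ℝ := fun n => C * θ ^ n
  have hρ : Tendsto ρ atTop (𝓝 0) := by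
    simpa using (tendsto_pow_atTop_nhds_zero_of_lt_one hθ0.le hθ1).const_mul C
  have hbd : ∀ (ω : ℕ → Fin 3) n m i j,
      |a ((List.range (n + m)).map ω) i - a ((List.range n).map ω) j| ≤ ρ n := by
    intro ω n m i j
    rw [range_map_add]
    simpa using hosc ((List.range n).map ω) ((List.range m).map fun k => ω (n + k)) i j
  have hcau : ∀ ω, CauchySeq fun n => a ((List.range n).map ω) 0 := by
    intro ω
    refine cauchySeq_of_le_tendsto_0' ρ (fun n m hnm => ?_) hρ
    obtain ⟨k, rfl⟩ := Nat.exists_eq_add_of_le hnm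
    rw [dist_comm]
    exact hbd ω n k 0 0
  choose H hH using fun ω => cauchySeq_tendsto_of_complete (hcau ω)
  have hHρ : ∀ ω n i, |H ω - a ((List.range n).map ω) i| ≤ ρ n := by
    intro ω n i
    refine le_of_tendsto (((hH ω).sub_const _).abs) ?_
    filter_upwards [eventually_ge_atTop n] with m hm
    obtain ⟨k, rfl⟩ := Nat.exists_eq_add_of_le hm
    exact hbd ω n k 0 i
  refine ⟨H, ?_, fun ω i => ?_⟩
  · have hu : TendstoUniformly (fun n (ω : ℕ → Fin 3) => a ((List.range n).map ω) 0) H atTop := by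
      rw [Metric.tendstoUniformly_iff]
      intro ε hε
      filter_upwards [hρ.eventually (gt_mem_nhds hε)] with n hn ω
      exact (hHρ ω n 0).trans_lt hn
    refine hu.continuous (Frequently.of_forall fun n => ?_)
    have e : (fun ω : ℕ → Fin 3 => a ((List.range n).map ω) 0) =
        (fun x : Fin n → Fin 3 => a (List.ofFn x) 0) ∘ fun ω k => ω k := by
      funext ω
      simp only [Function.comp]
      congr 1
      apply List.ext_getElem <;> simp
    rw [e]
    exact continuous_of_discreteTopology.comp (continuous_pi fun k => continuous_apply _)
  · rw [tendsto_iff_dist_tendsto_zero]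
    refine squeeze_zero (fun _ => dist_nonneg) (fun n => ?_) hρ
    rw [dist_comm]
    exact hHρ ω n i

/-- Vertex data extend to a continuous function on the gasket. -/
theorem IsVertexData.exists_continuousOn (h : IsVertexData a) {v : Fin 3 → Plane}
    {φ : Fin 3 → Plane → ℝ} (hφ : IsBarycentric v φ) :
    ∃ f : Plane → ℝ, ContinuousOn f (gasket v) ∧ ∀ w i, f (cellMap v w (v i)) = a w i := by
  obtain ⟨H, hHc, hH⟩ := h.exists_limit
  have hval : ∀ ω n i j, ω n = i → (∀ k, ω (n + 1 + k) = j) →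
      H ω = a ((List.range n).map ω ++ [i]) j := by
    intro ω n i j hi hj
    have h1 := (hH ω j).comp (tendsto_add_atTop_nat (n + 1))
    refine tendsto_nhds_unique h1 (tendsto_const_nhds.congr fun m => ?_)
    simp only [Function.comp]
    rw [add_comm, range_map_add, funext hj, range_map_const, h.replicate, range_map_add]
    simp [hi]
  -- Two addresses of one point end in `i j j j …` and `j i i i …` after a common prefix, so the
  -- limits agree by the junction condition.
  have hfac : Function.FactorsThrough H (address v) := by
    intro ω ω' e
    by_cases hne : ω = ω'
    · rw [hne]
    obtain ⟨n, h1, h2, h3⟩ := hφ.address_eq_address e hne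
    rw [hval ω n (ω n) (ω' n) rfl h2, hval ω' n (ω' n) (ω n) rfl h3, h.junction]
    congr 2
    exact List.map_congr_left fun k hk => h1 k (List.mem_range.1 hk)
  refine ⟨Function.extend (address v) H 0, ?_, fun w i => ?_⟩
  -- Continuity descends from address space because a continuous surjection from a compact space
  -- onto a Hausdorff space is a quotient map.
  · have hq : IsQuotientMap (rangeFactorization (address v)) := by
      have hc : Continuous (rangeFactorization (address v)) :=
        (address_continuous v).subtype_mk _
      exact hc.isClosedMap.isQuotientMap hc rangeFactorization_surjective
    rw [continuousOn_iff_continuous_domRestrict]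
    refine hq.continuous_iff.2 ?_
    convert hHc using 1
    funext ω
    exact hfac.extend_apply 0 ω
  · let ω : ℕ → Fin 3 := fun k => w.getD k i
    have hω : (List.range w.length).map ω = w := by
      apply List.ext_getElem <;> simp [ω]
      intro n h1
      simp [h1]
    have hadd : address v ω = cellMap v w (v i) := by
      conv_rhs => rw [← hω, ← address_truncate]
      congr 1
      funext k
      split_ifs with hk
      · rfl
      · simp [ω, not_lt.1 hk]
    rw [← hadd, hfac.extend_apply]
    refine tendsto_nhds_unique ((hH ω i).comp (tendsto_add_atTop_nat w.length))
      (tendsto_const_nhds.congr fun m => ?_)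
    simp only [Function.comp]
    rw [add_comm, range_map_add, hω]
    have : (fun k => ω (w.length + k)) = fun _ => i := by
      funext k; simp [ω]
    rw [this, range_map_const, h.replicate]

end VertexData

/-! ### Energies of all levels -/

lemma baseEnergy_nonneg {c : ℝ} (hc : 0 ≤ c) (a : Fin 3 → ℝ) : 0 ≤ baseEnergy c a := by
  unfold baseEnergy; positivity

lemma energy_zero (v : Fin 3 → Plane) (c : ℝ) (r : Fin 3 → ℝ) (u : Plane → ℝ) :
    energy v c r 0 u = baseEnergy c fun i => u (v i) := by
  simp [energy, cellRatio, cellMap]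

lemma cellRatio_cons (r : Fin 3 → ℝ) (i : Fin 3) (w : List (Fin 3)) :
    cellRatio r (i :: w) = r i * cellRatio r w := by simp [cellRatio]

lemma cellRatio_pos {r : Fin 3 → ℝ} (hr : ∀ i, 0 < r i) (w : List (Fin 3)) :
    0 < cellRatio r w := by
  induction w with
  | nil => simp [cellRatio]
  | cons i w ih => rw [cellRatio_cons]; exact mul_pos (hr i) ih

lemma energy_succ (v : Fin 3 → Plane) (c : ℝ) (r : Fin 3 → ℝ) (m : ℕ) (u : Plane → ℝ) :
    energy v c r (m + 1) u = ∑ i, (r i)⁻¹ * energy v c r m fun x => u (sgMap v i x) := by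
  simp only [energy, Finset.mul_sum]
  rw [← (Fin.consEquiv fun _ : Fin (m + 1) => Fin 3).sum_comp, Fintype.sum_prod_type]
  refine Finset.sum_congr rfl fun i _ => Finset.sum_congr rfl fun w _ => ?_
  simp [Fin.consEquiv, cellRatio_cons, cellMap_cons, mul_assoc, mul_comm]

lemma energy_nonneg (v : Fin 3 → Plane) {c : ℝ} {r : Fin 3 → ℝ} (hc : 0 ≤ c) (hr : ∀ i, 0 < r i)
    (m : ℕ) (u : Plane → ℝ) : 0 ≤ energy v c r m u :=
  Finset.sum_nonneg fun _ _ =>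
    mul_nonneg (inv_nonneg.2 (cellRatio_pos hr _).le) (baseEnergy_nonneg hc _)

lemma localEnergy_nonneg (v : Fin 3 → Plane) {c : ℝ} {r : Fin 3 → ℝ} (hc : 0 ≤ c)
    (hr : ∀ i, 0 < r i) (A : Finset (List (Fin 3))) (m : ℕ) (u : Plane → ℝ) :
    0 ≤ localEnergy v c r A m u :=
  Finset.sum_nonneg fun _ _ =>
    mul_nonneg (inv_nonneg.2 (cellRatio_pos hr _).le) (energy_nonneg v hc hr _ _)

lemma localEnergy_nil (v : Fin 3 → Plane) (c : ℝ) (r : Fin 3 → ℝ) (m : ℕ) (u : Plane → ℝ) :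
    localEnergy v c r {[]} m u = energy v c r m u := by
  simp [localEnergy, cellRatio]

lemma cellUnion_nil (v : Fin 3 → Plane) : cellUnion v {[]} = gasket v := by
  have : cellMap v [] = id := rfl
  simp [cellUnion, this]

lemma localEnergy_parallelogram (v : Fin 3 → Plane) (c : ℝ) (r : Fin 3 → ℝ)
    (A : Finset (List (Fin 3))) (m : ℕ) (f g : Plane → ℝ) :
    4 * localEnergy v c r A m (fun x => (f x + g x) / 2) +
      localEnergy v c r A m (fun x => f x - g x) =
      2 * localEnergy v c r A m f + 2 * localEnergy v c r A m g := by
  simp only [localEnergy, energy, Finset.mul_sum, ← Finset.sum_add_distrib]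
  refine Finset.sum_congr rfl fun w _ => Finset.sum_congr rfl fun w' _ => ?_
  simp only [baseEnergy]
  ring

/-! ### Monotonicity of energy and uniqueness of minimizers -/

section Structure

variable {v : Fin 3 → Plane} {c : ℝ} {r : Fin 3 → ℝ}

lemma IsBilateralStructure.baseEnergy_le_energy (hs : IsBilateralStructure v c r) (m : ℕ)
    (u : Plane → ℝ) : baseEnergy c (fun i => u (v i)) ≤ energy v c r m u := by
  induction m generalizing u with
  | zero => rw [energy_zero]
  | succ m ih =>
    refine ((hs.renorm fun i => u (v i)).2 ⟨u, fun i => rfl, rfl⟩).trans ?_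
    rw [energy_succ, energy_succ]
    refine Finset.sum_le_sum fun i _ => mul_le_mul_of_nonneg_left ?_ (inv_nonneg.2 (hs.r_pos i).le)
    rw [energy_zero]
    exact ih fun x => u (sgMap v i x)

/-- Zero energy at a high level forces zero `baseEnergy`, so all three corners share the value `0`.
The first cell of `w` also has zero energy and contains one of these corners, the fixed point of its
map, so the argument repeats along the word. -/
lemma IsBilateralStructure.eq_zero_of_energy_eq_zero (hs : IsBilateralStructure v c r)
    (w : List (Fin 3)) (u : Plane → ℝ) (h : energy v c r w.length u = 0) {i : Fin 3}
    (hi : u (v i) = 0) (j : Fin 3) : u (cellMap v w (v j)) = 0 := by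
  have h0 : ∀ k, u (v k) = 0 := by
    have h1 := hs.baseEnergy_le_energy w.length u
    have hc := hs.c_pos
    rw [h, baseEnergy] at h1
    have h2 : u (v 0) - u (v 1) = 0 := by
      refine pow_eq_zero_iff (n := 2) (by norm_num) |>.1 (le_antisymm ?_ (sq_nonneg _))
      nlinarith [sq_nonneg (u (v 0) - u (v 2)),
        mul_nonneg hc.le (sq_nonneg (u (v 1) - u (v 2)))]
    have h3 : u (v 0) - u (v 2) = 0 := by
      refine pow_eq_zero_iff (n := 2) (by norm_num) |>.1 (le_antisymm ?_ (sq_nonneg _))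
      nlinarith [sq_nonneg (u (v 0) - u (v 1)),
        mul_nonneg hc.le (sq_nonneg (u (v 1) - u (v 2)))]
    have h4 : u (v 0) = 0 := by fin_cases i <;> simp at hi <;> linarith
    intro k
    fin_cases k <;> simp <;> linarith
  cases w with
  | nil => exact h0 j
  | cons k w =>
    rw [List.length_cons, energy_succ, Finset.sum_eq_zero_iff_of_nonneg fun i _ =>
      mul_nonneg (inv_nonneg.2 (hs.r_pos i).le) (energy_nonneg v hs.c_pos.le hs.r_pos _ _)] at h
    have hk : energy v c r w.length (fun x => u (sgMap v k x)) = 0 :=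
      (mul_eq_zero.1 (h k (Finset.mem_univ _))).resolve_left (inv_ne_zero (hs.r_pos k).ne')
    exact hs.eq_zero_of_energy_eq_zero w (fun x => u (sgMap v k x)) hk (i := k)
      (by simp only [sgMap_self]; exact h0 k) j
termination_by w.length

/-- Uniqueness of harmonic extensions. -/
theorem IsBilateralStructure.eq_of_isHarmonicOn (hs : IsBilateralStructure v c r)
    {A : Finset (List (Fin 3))} {S : Set Plane} {f g : Plane → ℝ}
    (hf : IsHarmonicOn v c r A S f) (hg : IsHarmonicOn v c r A S g) (hfg : EqOn f g S)
    (hA : ∀ w ∈ A, ∃ i, cellMap v w (v i) ∈ S) :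
    (∀ w ∈ A, ∀ w' i, f (cellMap v (w ++ w') (v i)) = g (cellMap v (w ++ w') (v i))) ∧
      EqOn f g (cellUnion v A) := by
  have key : ∀ w ∈ A, ∀ w' i, f (cellMap v (w ++ w') (v i)) = g (cellMap v (w ++ w') (v i)) := by
    intro w hw w' j
    have hp := localEnergy_parallelogram v c r A w'.length f g
    -- The midpoint competes with both minimizers, and the parallelogram law then forces the
    -- difference to have zero energy.
    have h1 := hf.2 w'.length (fun x => (f x + g x) / 2) fun x hx => by
      simp only [hfg hx]; ring
    have h2 := hg.2 w'.length (fun x => (f x + g x) / 2) fun x hx => by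
      simp only [hfg hx]; ring
    have h0 : localEnergy v c r A w'.length (fun x => f x - g x) = 0 :=
      le_antisymm (by linarith) (localEnergy_nonneg v hs.c_pos.le hs.r_pos _ _ _)
    rw [localEnergy, Finset.sum_eq_zero_iff_of_nonneg fun w _ =>
      mul_nonneg (inv_nonneg.2 (cellRatio_pos hs.r_pos w).le)
        (energy_nonneg v hs.c_pos.le hs.r_pos _ _)] at h0
    have h3 := (mul_eq_zero.1 (h0 w hw)).resolve_left (inv_ne_zero (cellRatio_pos hs.r_pos w).ne')
    obtain ⟨i, hi⟩ := hA w hw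
    have h4 := hs.eq_zero_of_energy_eq_zero w' _ h3 (i := i) (by simp [hfg hi]) j
    rw [← cellMap_append] at h4
    linarith
  exact ⟨key, eqOn_cellUnion hf.1 hg.1 key⟩

end Structure

/-- The harmonic extension from the boundary to the three points `F_i v_j`, as transition
matrices. -/
noncomputable def transitionMatrix (c : ℝ) (r : Fin 3 → ℝ) : Fin 3 → Matrix (Fin 3) (Fin 3) ℝ :=
  let τ := r 0 * r 1 / (r 0 + (1 + c) * r 1)
  let p : Fin 3 → ℝ := ![1 - r 0, (r 0 + τ) / 2, (r 0 - τ) / 2]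
  let p' : Fin 3 → ℝ := ![1 - r 0, (r 0 - τ) / 2, (r 0 + τ) / 2]
  let q : Fin 3 → ℝ :=
    ![(1 - r 0) / (1 + c), (r 0 + c) / (2 * (1 + c)), (r 0 + c) / (2 * (1 + c))]
  ![!![1, 0, 0; p 0, p 1, p 2; p' 0, p' 1, p' 2],
    !![p 0, p 1, p 2; 0, 1, 0; q 0, q 1, q 2],
    !![p' 0, p' 1, p' 2; q 0, q 1, q 2; 0, 0, 1]]

/-- The algebraic form of the renormalization equation. -/
structure IsRenormSolution (c : ℝ) (r : Fin 3 → ℝ) : Prop where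
  c_pos : 0 < c
  r_pos : ∀ i, 0 < r i
  r_lt_one : ∀ i, r i < 1
  r_symm : r 2 = r 1
  symmetric : r 0 * (1 + 2 * c) + r 1 * (1 + c) = 1 + 2 * c
  antisymmetric : r 0 + (1 + c) * r 1 = r 1 * ((1 + 2 * c) * r 1 + 2 * r 0)

/-! ### The renormalization equation as an algebraic system -/

lemma energy_one (v : Fin 3 → Plane) (c : ℝ) (r : Fin 3 → ℝ) (u : Plane → ℝ) :
    energy v c r 1 u =
      (r 0)⁻¹ * ((u (v 0) - u (sgMap v 0 (v 1))) ^ 2 + (u (v 0) - u (sgMap v 0 (v 2))) ^ 2 +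
        c * (u (sgMap v 0 (v 1)) - u (sgMap v 0 (v 2))) ^ 2) +
      (r 1)⁻¹ * ((u (sgMap v 0 (v 1)) - u (v 1)) ^ 2 +
        (u (sgMap v 0 (v 1)) - u (sgMap v 1 (v 2))) ^ 2 +
        c * (u (v 1) - u (sgMap v 1 (v 2))) ^ 2) +
      (r 2)⁻¹ * ((u (sgMap v 0 (v 2)) - u (sgMap v 1 (v 2))) ^ 2 +
        (u (sgMap v 0 (v 2)) - u (v 2)) ^ 2 +
        c * (u (sgMap v 1 (v 2)) - u (v 2)) ^ 2) := by
  rw [energy_succ]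
  simp only [energy_zero, baseEnergy, Fin.sum_univ_three, sgMap_self, sgMap_comm v 1 0,
    sgMap_comm v 2 0, sgMap_comm v 2 1]

lemma IsBarycentric.exists_interpolation {v : Fin 3 → Plane} {φ : Fin 3 → Plane → ℝ}
    (hφ : IsBarycentric v φ) (a : Fin 3 → ℝ) (p p' q : ℝ) : ∃ u : Plane → ℝ,
      (∀ i, u (v i) = a i) ∧ u (sgMap v 0 (v 1)) = p ∧ u (sgMap v 0 (v 2)) = p' ∧
        u (sgMap v 1 (v 2)) = q := by
  -- Quadratic Lagrange interpolation at the vertices and edge midpoints of the triangle.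
  refine ⟨fun x => a 0 * (φ 0 x * (2 * φ 0 x - 1)) + a 1 * (φ 1 x * (2 * φ 1 x - 1)) +
    a 2 * (φ 2 x * (2 * φ 2 x - 1)) + 4 * p * (φ 0 x * φ 1 x) + 4 * p' * (φ 0 x * φ 2 x) +
    4 * q * (φ 1 x * φ 2 x), fun i => ?_, ?_, ?_, ?_⟩
  · fin_cases i <;> simp [hφ.vertex] <;> norm_num
  all_goals simp [hφ.vertex, hφ.map]; ring

/-- In means and half differences under the reflection exchanging `v_2` and `v_3`, the energy splits
into an even part in `(p + p') / 2`, `q` and an odd part in `(p - p') / 2`. The last three squares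
vanish exactly at the minimizer. -/
lemma energy_one_eq_add_sq {c r₀ r₁ : ℝ} (hc : 0 < c) (h0 : 0 < r₀) (h1 : 0 < r₁)
    (x y z p p' q : ℝ) :
      (r₀)⁻¹ * ((x - p) ^ 2 + (x - p') ^ 2 + c * (p - p') ^ 2) +
      (r₁)⁻¹ * ((p - y) ^ 2 + (p - q) ^ 2 + c * (y - q) ^ 2) +
      (r₁)⁻¹ * ((p' - q) ^ 2 + (p' - z) ^ 2 + c * (q - z) ^ 2) =
      2 * ((1 + 2 * c) / (r₀ * (1 + 2 * c) + r₁ * (1 + c))) * (x - (y + z) / 2) ^ 2 +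
        2 * ((1 + 2 * c) * (r₀ + (1 + c) * r₁) / (r₁ * ((1 + 2 * c) * r₁ + 2 * r₀))) *
          ((y - z) / 2) ^ 2 +
      (2 * ((r₀ * (1 + 2 * c) + r₁ * (1 + c)) / (r₀ * r₁ * (1 + c))) *
        ((p + p') / 2 - ((1 + c) * r₁ * x + (1 + 2 * c) * r₀ * ((y + z) / 2)) /
          (r₀ * (1 + 2 * c) + r₁ * (1 + c))) ^ 2 +
      2 * ((1 + c) / r₁) * (q - ((p + p') / 2 + c * ((y + z) / 2)) / (1 + c)) ^ 2 +
      2 * (((1 + 2 * c) * r₁ + 2 * r₀) / (r₀ * r₁)) *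
        ((p - p') / 2 - r₀ / ((1 + 2 * c) * r₁ + 2 * r₀) * ((y - z) / 2)) ^ 2) := by
  field_simp
  ring

/-- Completing squares in the level one energy: the trace on the boundary is diagonal in
coordinates adapted to the symmetry. -/
lemma isLeast_energy_one {v : Fin 3 → Plane} {φ : Fin 3 → Plane → ℝ}
    (hφ : IsBarycentric v φ) {c : ℝ} {r : Fin 3 → ℝ} (hc : 0 < c) (hr : ∀ i, 0 < r i)
    (hsymm : r 2 = r 1) (a : Fin 3 → ℝ) :
    IsLeast {e | ∃ u : Plane → ℝ, (∀ i, u (v i) = a i) ∧ e = energy v c r 1 u}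
      (2 * ((1 + 2 * c) / (r 0 * (1 + 2 * c) + r 1 * (1 + c))) * (a 0 - (a 1 + a 2) / 2) ^ 2 +
        2 * ((1 + 2 * c) * (r 0 + (1 + c) * r 1) / (r 1 * ((1 + 2 * c) * r 1 + 2 * r 0))) *
          ((a 1 - a 2) / 2) ^ 2) := by
  have h0 := hr 0
  have h1 := hr 1
  have key := energy_one_eq_add_sq hc h0 h1
  constructor
  · let P := ((1 + c) * r 1 * a 0 + (1 + 2 * c) * r 0 * ((a 1 + a 2) / 2)) /
          (r 0 * (1 + 2 * c) + r 1 * (1 + c))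
    let D := r 0 / ((1 + 2 * c) * r 1 + 2 * r 0) * ((a 1 - a 2) / 2)
    obtain ⟨u, hu, e1, e2, e3⟩ := hφ.exists_interpolation a (P + D) (P - D)
      ((P + c * ((a 1 + a 2) / 2)) / (1 + c))
    refine ⟨u, hu, ?_⟩
    rw [energy_one, e1, e2, e3, hu, hu, hu, hsymm, key]
    have hP : (P + D + (P - D)) / 2 = P := by ring
    have hD : (P + D - (P - D)) / 2 = D := by ring
    rw [hP, hD]
    simp [P, D]
  · rintro _ ⟨u, hu, rfl⟩
    rw [energy_one, hsymm, key, hu, hu, hu]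
    refine le_add_of_nonneg_right ?_
    positivity

lemma IsBilateralStructure.isRenormSolution {v : Fin 3 → Plane} {φ : Fin 3 → Plane → ℝ}
    (hφ : IsBarycentric v φ) {c : ℝ} {r : Fin 3 → ℝ} (hs : IsBilateralStructure v c r) :
    IsRenormSolution c r := by
  have h0 := hs.r_pos 0
  have h1 := hs.r_pos 1
  have hc := hs.c_pos
  have e := fun a => (hs.renorm a).unique
    (isLeast_energy_one hφ hs.c_pos hs.r_pos hs.r_symm.symm a)
  -- One even and one odd test vector suffice, since both quadratic forms are diagonal in these
  -- coordinates.
  have e1 := e ![1, 0, 0]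
  have e2 := e ![0, 1, -1]
  simp [baseEnergy] at e1 e2
  refine ⟨hc, hs.r_pos, hs.r_lt_one, hs.r_symm.symm, ?_, ?_⟩
  · field_simp at e1
    linarith
  · norm_num at e2
    field_simp at e2
    have h3 : (1 + 2 * c) * (r 0 + (1 + c) * r 1) =
      (1 + 2 * c) * (r 1 * ((1 + 2 * c) * r 1 + 2 * r 0)) := by linarith
    exact mul_left_cancel₀ (by positivity) h3

lemma IsRenormSolution.isBilateralStructure {v : Fin 3 → Plane} {φ : Fin 3 → Plane → ℝ}
    (hφ : IsBarycentric v φ) {c : ℝ} {r : Fin 3 → ℝ} (hs : IsRenormSolution c r) :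
    IsBilateralStructure v c r := by
  refine ⟨hs.c_pos, hs.r_pos, hs.r_lt_one, hs.r_symm.symm, fun a => ?_⟩
  have hc := hs.c_pos
  have h0 := hs.r_pos 0
  have h1 := hs.r_pos 1
  convert isLeast_energy_one hφ hs.c_pos hs.r_pos hs.r_symm a using 1
  rw [hs.symmetric, ← hs.antisymmetric, mul_div_assoc, div_self (by positivity),
    div_self (by positivity), baseEnergy]
  ring

lemma exists_isRenormSolution {s : ℝ} (hs : |s - 1| < 1 / 4) :
    ∃ (c : ℝ) (r : Fin 3 → ℝ), IsRenormSolution c r ∧ r 1 / r 0 = s := by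
  obtain ⟨hs1, hs2⟩ := abs_lt.1 hs
  -- The even equation together with `r 1 = s * r 0` determines `r` from `c`; substituted into the
  -- odd equation, it leaves this quadratic in `A = 1 + c`. Its value at `1` is `-1`, and at `20` it
  -- is positive for all `s` in the range.
  let P : ℝ → ℝ := fun A => (3 * s ^ 2 - 2 * s) * A ^ 2 - (4 * s ^ 2 - 4 * s + 2) * A + (s - 1) ^ 2
  have hP : ContinuousOn P (Icc 1 20) := by fun_prop
  have hP1 : P 1 < 0 := by simp only [P]; nlinarith
  have hP20 : 0 < P 20 := by simp only [P]; nlinarith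
  obtain ⟨A, hA, hA0⟩ := intermediate_value_Icc (by norm_num) hP ⟨hP1.le, hP20.le⟩
  have hA1 : 1 < A := lt_of_le_of_ne hA.1 fun h => by rw [← h] at hA0; exact hP1.ne hA0
  obtain ⟨c, rfl⟩ : ∃ c, A = 1 + c := ⟨A - 1, by ring⟩
  have hc : 0 < c := by linarith
  have hs0 : 0 < s := by linarith
  have hden : 0 < 1 + 2 * c + s * (1 + c) := by positivity
  simp only [P] at hA0
  refine ⟨c, ![(1 + 2 * c) / (1 + 2 * c + s * (1 + c)), s * (1 + 2 * c) / (1 + 2 * c + s * (1 + c)),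
    s * (1 + 2 * c) / (1 + 2 * c + s * (1 + c))], ⟨hc, ?_, ?_, rfl, ?_, ?_⟩, ?_⟩
  · intro i; fin_cases i <;> simp <;> positivity
  · have hA : (1 + 2 * c) / (1 + 2 * c + s * (1 + c)) < 1 := by
      rw [div_lt_one hden]
      have : 0 < s * (1 + c) := by positivity
      linarith
    have hB : s * (1 + 2 * c) / (1 + 2 * c + s * (1 + c)) < 1 := by
      rw [div_lt_one hden]
      nlinarith
    intro i; fin_cases i <;> simp [hA, hB]
  · simp; field_simp
  · simp; field_simp
    linear_combination (-1 : ℝ) * hA0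
  · simp; field_simp

/-- Vertex data may be checked on the three cells of level one, where each restriction either
consists of vertex data or is a contracted copy of the whole. -/
lemma IsVertexData.of_children {a : List (Fin 3) → Fin 3 → ℝ}
    (h : ∀ i, IsVertexData (fun w => a (i :: w)) ∨
      ∃ η : ℝ, |η| < 1 ∧ ∀ w k, a (i :: w) k = η * a w k)
    (hc : ∀ j, a [j] j = a [] j) (hj : ∀ i j, a [i] j = a [j] i) : IsVertexData a := by
  refine ⟨fun w j => ?_, fun w i j => ?_, ?_⟩
  · induction w with
    | nil => exact hc j
    | cons k w ih =>
      rcases h k with hk | ⟨η, -, hη⟩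
      · exact hk.corner w j
      · rw [List.cons_append, hη, hη, ih]
  · induction w with
    | nil => exact hj i j
    | cons k w ih =>
      rcases h k with hk | ⟨η, -, hη⟩
      · exact hk.junction w i j
      · rw [List.cons_append, List.cons_append, hη, hη, ih]
  · have h' : ∀ i, ∃ C θ : ℝ, 0 ≤ C ∧ 0 < θ ∧ θ < 1 ∧
        ((∀ w w' k l, |a (i :: (w ++ w')) k - a (i :: w) l| ≤ C * θ ^ w.length) ∨
          ∃ η : ℝ, |η| ≤ θ ∧ ∀ w k, a (i :: w) k = η * a w k) := by
      intro i
      rcases h i with hi | ⟨η, h1, h2⟩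
      · obtain ⟨C, θ, hC, h0, h1, h2⟩ := hi.oscillation
        exact ⟨C, θ, hC, h0, h1, Or.inl h2⟩
      · refine ⟨0, (|η| + 1) / 2, le_rfl, by positivity, by linarith, Or.inr ⟨η, by linarith, h2⟩⟩
    choose C θ hC0 hθ0 hθ1 hCθ using h'
    obtain ⟨i₀, hi₀⟩ := Finite.exists_max θ
    obtain ⟨i₁, hi₁⟩ := Finite.exists_max C
    set t := θ i₀ with ht
    set D := C i₁ with hD
    have ht0 : 0 < t := hθ0 _
    have ht1 : t < 1 := hθ1 _
    have hD0 : 0 ≤ D := hC0 _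
    -- Uniform bound by induction on the word: a contracted child inherits it, and a child with
    -- vertex data is bounded through its own oscillation estimate at the empty word.
    obtain ⟨B, hB⟩ : ∃ B, ∀ w k, |a w k| ≤ B := by
      refine ⟨∑ k, |a [] k| + ∑ i, (|a [i] 0| + C i), fun w => ?_⟩
      have e1 : ∀ k, |a [] k| ≤ ∑ k, |a [] k| := fun k =>
        Finset.single_le_sum (f := fun k => |a [] k|) (fun _ _ => abs_nonneg _) (Finset.mem_univ k)
      have e2 : ∀ k, |a [k] 0| + C k ≤ ∑ i, (|a [i] 0| + C i) := fun k =>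
        Finset.single_le_sum (f := fun k => |a [k] 0| + C k)
          (fun k _ => add_nonneg (abs_nonneg _) (hC0 k)) (Finset.mem_univ k)
      induction w with
      | nil =>
        intro k
        have := e2 0
        have := hC0 0
        have := abs_nonneg (a [0] 0)
        linarith [e1 k]
      | cons i w ih =>
        intro k
        rcases hCθ i with hi | ⟨η, h1, h2⟩
        · have h3 := hi [] w k 0
          simp only [List.nil_append, List.length_nil, pow_zero, mul_one] at h3
          have h4 := abs_sub_abs_le_abs_sub (a (i :: w) k) (a [i] 0)
          have := abs_nonneg (a [] 0)
          linarith [e2 i, e1 0]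
        · rw [h2, abs_mul]
          have := hθ1 i
          exact (mul_le_of_le_one_left (abs_nonneg _) (by linarith)).trans (ih k)
    have hB0 : 0 ≤ B := (abs_nonneg _).trans (hB [] 0)
    -- `2 * B` covers the empty word, and `D / t` pays for the first letter, which the estimate
    -- inside a child does not count.
    refine ⟨2 * B + D / t, t, by positivity, ht0, ht1, fun w w' k l => ?_⟩
    induction w with
    | nil =>
      have := abs_sub (a w' k) (a [] l)
      have := hB w' k
      have := hB [] l
      have : 0 ≤ D / t := by positivity
      simp only [List.nil_append, List.length_nil, pow_zero, mul_one]
      linarith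
    | cons i w ih =>
      rcases hCθ i with hi | ⟨η, h1, h2⟩
      · refine (hi w w' k l).trans ?_
        have e1 : C i * θ i ^ w.length ≤ D * t ^ w.length :=
          mul_le_mul (hi₁ i) (pow_le_pow_left₀ (hθ0 i).le (hi₀ i) _) (by have := hθ0 i; positivity) hD0
        have e2 : D * t ^ w.length = D / t * t ^ (w.length + 1) := by
          rw [pow_succ]; field_simp
        rw [List.length_cons, add_mul, ← e2]
        have : 0 ≤ 2 * B * t ^ (w.length + 1) := by positivity
        linarith
      · rw [List.cons_append, h2, h2, ← mul_sub, abs_mul, List.length_cons, pow_succ]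
        calc |η| * |a (w ++ w') k - a w l| ≤ t * ((2 * B + D / t) * t ^ w.length) :=
              mul_le_mul (h1.trans (hi₀ i)) ih (abs_nonneg _) ht0.le
          _ = _ := by ring

/-- The values at the vertices of the harmonic function with given boundary values. -/
noncomputable def harmonicData (c : ℝ) (r : Fin 3 → ℝ) :
    List (Fin 3) → (Fin 3 → ℝ) → Fin 3 → ℝ
  | [], a => a
  | i :: w, a => harmonicData c r w ((transitionMatrix c r i).mulVec a)

/-! ### Harmonic extension by transition matrices -/

section HarmonicData

variable {c : ℝ} {r : Fin 3 → ℝ}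

@[simp] lemma harmonicData_nil (a : Fin 3 → ℝ) : harmonicData c r [] a = a := rfl

lemma harmonicData_cons (i : Fin 3) (w : List (Fin 3)) (a : Fin 3 → ℝ) :
    harmonicData c r (i :: w) a = harmonicData c r w ((transitionMatrix c r i).mulVec a) := rfl

lemma harmonicData_append (w w' : List (Fin 3)) (a : Fin 3 → ℝ) :
    harmonicData c r (w ++ w') a = harmonicData c r w' (harmonicData c r w a) := by
  induction w generalizing a with
  | nil => rfl
  | cons i w ih => exact ih _

lemma harmonicData_add (w : List (Fin 3)) (a b : Fin 3 → ℝ) :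
    harmonicData c r w (a + b) = harmonicData c r w a + harmonicData c r w b := by
  induction w generalizing a b with
  | nil => rfl
  | cons i w ih => simp only [harmonicData_cons, Matrix.mulVec_add, ih]

lemma harmonicData_smul (w : List (Fin 3)) (t : ℝ) (a : Fin 3 → ℝ) :
    harmonicData c r w (t • a) = t • harmonicData c r w a := by
  induction w generalizing a with
  | nil => rfl
  | cons i w ih => simp only [harmonicData_cons, Matrix.mulVec_smul, ih]

lemma harmonicData_zero (w : List (Fin 3)) : harmonicData c r w 0 = 0 := by
  simpa using harmonicData_smul (c := c) (r := r) w 0 0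

lemma harmonicData_replicate {j : Fin 3} {a : Fin 3 → ℝ} {t : ℝ}
    (h : (transitionMatrix c r j).mulVec a = t • a) (m : ℕ) :
    harmonicData c r (List.replicate m j) a = t ^ m • a := by
  induction m with
  | zero => simp
  | succ m ih => rw [List.replicate_succ, harmonicData_cons, h, harmonicData_smul, ih, smul_smul,
      pow_succ']

lemma transitionMatrix_corner (j : Fin 3) (a : Fin 3 → ℝ) :
    (transitionMatrix c r j).mulVec a j = a j := by
  fin_cases j <;> simp [transitionMatrix, Matrix.mulVec, dotProduct, Fin.sum_univ_three]

lemma transitionMatrix_junction (i j : Fin 3) (a : Fin 3 → ℝ) :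
    (transitionMatrix c r i).mulVec a j = (transitionMatrix c r j).mulVec a i := by
  fin_cases i <;> fin_cases j <;>
    simp [transitionMatrix, Matrix.mulVec, dotProduct, Fin.sum_univ_three]

lemma IsRenormSolution.stochastic (hs : IsRenormSolution c r) (i k : Fin 3) :
    (∀ l, 0 ≤ transitionMatrix c r i k l) ∧ 0 < transitionMatrix c r i k i ∧
      ∑ l, transitionMatrix c r i k l = 1 := by
  have hc := hs.c_pos
  have h0 := hs.r_pos 0
  have h1 := hs.r_pos 1
  have h2 := hs.r_lt_one 0
  set τ := r 0 * r 1 / (r 0 + (1 + c) * r 1) with hτ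
  have hτ0 : 0 < τ := by positivity
  have hτ1 : τ < r 0 := by
    rw [hτ, div_lt_iff₀ (by positivity)]
    have : 0 < r 0 * r 0 + r 0 * (c * r 1) := by positivity
    linarith
  have e1 : 0 < 1 - r 0 := by linarith
  have e2 : 0 < (r 0 + τ) / 2 := by positivity
  have e3 : 0 < (r 0 - τ) / 2 := by linarith
  have e4 : 0 < (r 0 + c) / (2 * (1 + c)) := by positivity
  have e5 : 0 < (1 - r 0) / (1 + c) := by positivity
  have e6 : 1 - r 0 + (r 0 + τ) / 2 + (r 0 - τ) / 2 = 1 := by ring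
  have e7 : 1 - r 0 + (r 0 - τ) / 2 + (r 0 + τ) / 2 = 1 := by ring
  have e8 : (1 - r 0) / (1 + c) + (r 0 + c) / (2 * (1 + c)) + (r 0 + c) / (2 * (1 + c)) = 1 := by
    field_simp; ring
  refine ⟨fun l => ?_, ?_, ?_⟩
  · fin_cases i <;> fin_cases k <;> fin_cases l <;> simp [transitionMatrix, ← hτ] <;> linarith
  · fin_cases i <;> fin_cases k <;> simp [transitionMatrix, ← hτ] <;> linarith
  · fin_cases i <;> fin_cases k <;> simp [transitionMatrix, Fin.sum_univ_three, ← hτ, e6, e7, e8]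

/-- Every row of `M_i` is a probability vector whose weight at column `i` is at least some `δ > 0`.
Each new value is thus pulled towards the same number `a i`, which shortens the interval of values
by the factor `1 - δ`. -/
lemma IsRenormSolution.exists_contraction (hs : IsRenormSolution c r) :
    ∃ θ : ℝ, 0 < θ ∧ θ < 1 ∧ ∀ i (a : Fin 3 → ℝ) lo hi, (∀ k, lo ≤ a k ∧ a k ≤ hi) →
      ∃ lo' hi', lo ≤ lo' ∧ hi' ≤ hi ∧ hi' - lo' = θ * (hi - lo) ∧
        ∀ k, lo' ≤ (transitionMatrix c r i).mulVec a k ∧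
          (transitionMatrix c r i).mulVec a k ≤ hi' := by
  obtain ⟨x, hx⟩ := Finite.exists_min fun x : Fin 3 × Fin 3 => transitionMatrix c r x.1 x.2 x.1
  -- Halving ensures `δ < 1`; the corner row has weight exactly `1` at column `i`.
  set δ := transitionMatrix c r x.1 x.2 x.1 / 2
  have hδ0 : 0 < δ := half_pos (hs.stochastic x.1 x.2).2.1
  have hδ : ∀ i k, δ ≤ transitionMatrix c r i k i := fun i k =>
    (half_le_self (hs.stochastic x.1 x.2).2.1.le).trans (hx (i, k))
  have hδ1 : δ < 1 := by
    have h1 := hs.stochastic x.1 x.2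
    have h2 := Finset.single_le_sum (f := fun l => transitionMatrix c r x.1 x.2 l)
      (fun l _ => h1.1 l) (Finset.mem_univ x.1)
    rw [h1.2.2] at h2
    have : δ ≤ 1 / 2 := by simp only [δ]; linarith
    linarith
  refine ⟨1 - δ, by linarith, by linarith, fun i a lo hi h => ?_⟩
  have h1 := h i
  refine ⟨lo + δ * (a i - lo), hi - δ * (hi - a i), ?_, ?_, by ring, fun k => ?_⟩
  · nlinarith
  · nlinarith
  obtain ⟨hn, -, hsum⟩ := hs.stochastic i k
  have key : ∀ b : Fin 3 → ℝ, (∀ l, 0 ≤ b l) → δ * b i ≤ ∑ l, transitionMatrix c r i k l * b l := by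
    intro b hb
    refine (mul_le_mul_of_nonneg_right (hδ i k) (hb i)).trans ?_
    exact Finset.single_le_sum (f := fun l => transitionMatrix c r i k l * b l)
      (fun l _ => mul_nonneg (hn l) (hb l)) (Finset.mem_univ i)
  constructor
  · have := key (fun l => a l - lo) fun l => sub_nonneg.2 (h l).1
    simp only [mul_sub, Finset.sum_sub_distrib, ← Finset.sum_mul, hsum] at this
    simp only [Matrix.mulVec, dotProduct]
    linarith
  · have := key (fun l => hi - a l) fun l => sub_nonneg.2 (h l).2
    simp only [mul_sub, Finset.sum_sub_distrib, ← Finset.sum_mul, hsum] at this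
    simp only [Matrix.mulVec, dotProduct]
    linarith

lemma IsRenormSolution.isVertexData (hs : IsRenormSolution c r) (a : Fin 3 → ℝ) :
    IsVertexData fun w => harmonicData c r w a := by
  refine ⟨fun w j => ?_, fun w i j => ?_, ?_⟩
  · rw [harmonicData_append]; exact transitionMatrix_corner j _
  · rw [harmonicData_append, harmonicData_append]; exact transitionMatrix_junction i j _
  obtain ⟨θ, hθ0, hθ1, hθ⟩ := hs.exists_contraction
  have hbox : ∀ (w : List (Fin 3)) (a : Fin 3 → ℝ) lo hi, (∀ k, lo ≤ a k ∧ a k ≤ hi) →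
      ∃ lo' hi', lo ≤ lo' ∧ hi' ≤ hi ∧ hi' - lo' = θ ^ w.length * (hi - lo) ∧
        ∀ k, lo' ≤ harmonicData c r w a k ∧ harmonicData c r w a k ≤ hi' := by
    intro w
    induction w with
    | nil => intro a lo hi h; exact ⟨lo, hi, le_rfl, le_rfl, by simp, h⟩
    | cons i w ih =>
      intro a lo hi h
      obtain ⟨lo', hi', h1, h2, h3, h4⟩ := hθ i a lo hi h
      obtain ⟨lo'', hi'', h5, h6, h7, h8⟩ := ih _ lo' hi' h4
      refine ⟨lo'', hi'', h1.trans h5, h6.trans h2, ?_, h8⟩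
      rw [h7, h3, List.length_cons, pow_succ, mul_assoc]
  obtain ⟨k, hk⟩ := Finite.exists_min a
  obtain ⟨l, hl⟩ := Finite.exists_max a
  refine ⟨a l - a k, θ, by linarith [hk l], hθ0, hθ1, fun w w' i j => ?_⟩
  obtain ⟨lo, hi, -, -, h3, h4⟩ := hbox w a (a k) (a l) fun p => ⟨hk p, hl p⟩
  obtain ⟨lo', hi', h5, h6, -, h8⟩ := hbox w' _ lo hi h4
  rw [harmonicData_append, mul_comm, ← h3, abs_le]
  have := h8 i
  have := h4 j
  constructor <;> linarith

/-- The transition matrices place the midpoint values where the three extra squares of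
`energy_one_eq_add_sq` vanish, and the renormalization equations make the remaining coefficients
those of `baseEnergy`. -/
lemma IsRenormSolution.sum_baseEnergy (hs : IsRenormSolution c r) (a : Fin 3 → ℝ) :
    ∑ i, (r i)⁻¹ * baseEnergy c ((transitionMatrix c r i).mulVec a) = baseEnergy c a := by
  have hc := hs.c_pos
  have h0 := hs.r_pos 0
  have h1 := hs.r_pos 1
  have hS := hs.symmetric
  have hA := hs.antisymmetric
  set τ := r 0 * r 1 / (r 0 + (1 + c) * r 1) with hτ
  have e1 : ((1 + c) * r 1 * a 0 + (1 + 2 * c) * r 0 * ((a 1 + a 2) / 2)) / (1 + 2 * c) =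
      (1 - r 0) * a 0 + r 0 * ((a 1 + a 2) / 2) := by
    field_simp
    linear_combination 2 * a 0 * hS
  have e2 : r 0 / ((1 + 2 * c) * r 1 + 2 * r 0) = τ := by
    rw [hτ, hA]; field_simp
  have key := energy_one_eq_add_sq hc h0 h1 (a 0) (a 1) (a 2)
    ((1 - r 0) * a 0 + (r 0 + τ) / 2 * a 1 + (r 0 - τ) / 2 * a 2)
    ((1 - r 0) * a 0 + (r 0 - τ) / 2 * a 1 + (r 0 + τ) / 2 * a 2)
    ((1 - r 0) / (1 + c) * a 0 + (r 0 + c) / (2 * (1 + c)) * a 1 + (r 0 + c) / (2 * (1 + c)) * a 2)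
  have e3 : (1 + 2 * c) * (r 0 + (1 + c) * r 1) / (r 1 * ((1 + 2 * c) * r 1 + 2 * r 0)) =
      1 + 2 * c := by
    rw [← hA]; field_simp
  rw [e3, hS, e1, e2, div_self (by positivity)] at key
  rw [Fin.sum_univ_three, hs.r_symm]
  simp only [transitionMatrix, Matrix.mulVec, dotProduct, Fin.sum_univ_three, baseEnergy, ← hτ]
  simp
  rw [key]
  have d1 : ((1 - r 0) * a 0 + (r 0 + τ) / 2 * a 1 + (r 0 - τ) / 2 * a 2 +
    ((1 - r 0) * a 0 + (r 0 - τ) / 2 * a 1 + (r 0 + τ) / 2 * a 2)) / 2 -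
    ((1 - r 0) * a 0 + r 0 * ((a 1 + a 2) / 2)) = 0 := by ring
  have d2 : (1 - r 0) / (1 + c) * a 0 + (r 0 + c) / (2 * (1 + c)) * a 1 +
    (r 0 + c) / (2 * (1 + c)) * a 2 - (((1 - r 0) * a 0 + (r 0 + τ) / 2 * a 1 +
    (r 0 - τ) / 2 * a 2 + ((1 - r 0) * a 0 + (r 0 - τ) / 2 * a 1 +
    (r 0 + τ) / 2 * a 2)) / 2 + c * ((a 1 + a 2) / 2)) / (1 + c) = 0 := by
    field_simp; ring
  have d3 : ((1 - r 0) * a 0 + (r 0 + τ) / 2 * a 1 + (r 0 - τ) / 2 * a 2 -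
    ((1 - r 0) * a 0 + (r 0 - τ) / 2 * a 1 + (r 0 + τ) / 2 * a 2)) / 2 -
    τ * ((a 1 - a 2) / 2) = 0 := by ring
  rw [d1, d2, d3]
  ring

end HarmonicData

/-- `u` takes at all vertices the values of the harmonic function with its boundary values `t`. -/
def HasHarmonicValues (v : Fin 3 → Plane) (c : ℝ) (r : Fin 3 → ℝ) (t : Fin 3 → ℝ)
    (u : Plane → ℝ) : Prop :=
  ∀ w i, u (cellMap v w (v i)) = harmonicData c r w t i

/-! ### Existence of harmonic functions -/

section HasHarmonicValues

variable {v : Fin 3 → Plane} {c : ℝ} {r : Fin 3 → ℝ} {φ : Fin 3 → Plane → ℝ}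

lemma HasHarmonicValues.energy_eq {t : Fin 3 → ℝ} {u : Plane → ℝ}
    (h : HasHarmonicValues v c r t u) (hs : IsRenormSolution c r) (m : ℕ) :
    energy v c r m u = baseEnergy c t := by
  induction m generalizing t u with
  | zero => rw [energy_zero]; congr 1; funext i; exact h [] i
  | succ m ih =>
    rw [energy_succ, ← hs.sum_baseEnergy]
    refine Finset.sum_congr rfl fun i _ => ?_
    rw [ih (u := fun x => u (sgMap v i x)) fun w k => h (i :: w) k]

lemma exists_piecewise_harmonic (hφ : IsBarycentric v φ) (hs : IsRenormSolution c r)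
    (b : Fin 3 → Fin 3 → ℝ) (hb : ∀ i j, b i j = b j i) :
    ∃ f : Plane → ℝ, ContinuousOn f (gasket v) ∧
      ∀ i, HasHarmonicValues v c r (b i) fun x => f (sgMap v i x) := by
  let a : List (Fin 3) → Fin 3 → ℝ := fun w =>
    match w with
    | [] => fun j => b j j
    | i :: w => harmonicData c r w (b i)
  have ha : IsVertexData a := IsVertexData.of_children (fun i => Or.inl (hs.isVertexData (b i)))
    (fun j => rfl) hb
  obtain ⟨f, hf, hfa⟩ := ha.exists_continuousOn hφ
  exact ⟨f, hf, fun i w k => hfa (i :: w) k⟩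

lemma exists_harmonic (hφ : IsBarycentric v φ) (hs : IsRenormSolution c r) (t : Fin 3 → ℝ) :
    ∃ f : Plane → ℝ, IsHarmonic v c r f ∧ HasHarmonicValues v c r t f := by
  obtain ⟨f, hf, hfa⟩ := (hs.isVertexData t).exists_continuousOn hφ
  refine ⟨f, ⟨by rwa [cellUnion_nil], fun m u hu => ?_⟩, hfa⟩
  rw [localEnergy_nil, localEnergy_nil, HasHarmonicValues.energy_eq hfa hs]
  convert (hs.isBilateralStructure hφ).baseEnergy_le_energy m u using 2
  funext i
  rw [hu ⟨i, rfl⟩]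
  exact (hfa [] i).symm

/-- By uniqueness of minimizers, comparison with the harmonic function built from the matrices. -/
lemma IsHarmonic.hasHarmonicValues {h : Plane → ℝ} (hh : IsHarmonic v c r h)
    (hφ : IsBarycentric v φ) (hs : IsRenormSolution c r) :
    HasHarmonicValues v c r (fun i => h (v i)) h := by
  obtain ⟨f, hf, hfv⟩ := exists_harmonic hφ hs fun i => h (v i)
  have key := (hs.isBilateralStructure hφ).eq_of_isHarmonicOn hh hf
    (by rintro _ ⟨i, rfl⟩; exact (hfv [] i).symm)
    (by simp only [Finset.mem_singleton]; rintro w rfl; exact ⟨0, 0, rfl⟩)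
  intro w i
  have := key.1 [] (by simp) w i
  rw [List.nil_append] at this
  rw [this, hfv]

end HasHarmonicValues

/-- A parametrization of the solutions of the renormalization equation in which the transition
matrices and their eigenvectors are polynomial. -/
structure IsRenormParam (c : ℝ) (r : Fin 3 → ℝ) (d g : ℝ) : Prop where
  c_pos : 0 < c
  d_pos : 0 < d
  g_pos : 0 < g
  r_zero : r 0 = 1 - (1 + c) * d
  r_one : r 1 = (1 + 2 * c) * d
  r_two : r 2 = (1 + 2 * c) * d
  r_lt_one : ∀ i, r i < 1
  two_mul_g : 2 * g = (3 + 4 * c) * d - 1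
  lt_r_zero : 2 * (c * g) < r 0
  matrix_zero : transitionMatrix c r 0 =
    !![1, 0, 0; (1 + c) * d, r 0 - c * g, c * g; (1 + c) * d, c * g, r 0 - c * g]
  matrix_one : transitionMatrix c r 1 =
    !![(1 + c) * d, r 0 - c * g, c * g; 0, 1, 0; d, (1 - d) / 2, (1 - d) / 2]
  matrix_two : transitionMatrix c r 2 =
    !![(1 + c) * d, c * g, r 0 - c * g; d, (1 - d) / 2, (1 - d) / 2; 0, 0, 1]

/-- With `d = r 1 / (1 + 2 * c)` the even equation becomes linear and gives `r 0`. The odd equation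
then says that the rational quantity `τ` equals `r 0 - 2 * (c * g)`, which makes the matrices
polynomial; `g > 0` follows from `τ < r 0`. -/
lemma IsRenormSolution.exists_param {c : ℝ} {r : Fin 3 → ℝ} (hs : IsRenormSolution c r) :
    ∃ d g, IsRenormParam c r d g := by
  have hc := hs.c_pos
  have h0 := hs.r_pos 0
  have h1 := hs.r_pos 1
  have hA := hs.antisymmetric
  obtain ⟨d, hd⟩ : ∃ d, r 1 = (1 + 2 * c) * d := ⟨r 1 / (1 + 2 * c), by field_simp⟩
  obtain ⟨g, hg⟩ : ∃ g, 2 * g = (3 + 4 * c) * d - 1 := ⟨((3 + 4 * c) * d - 1) / 2, by ring⟩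
  have hd0 : 0 < d := by
    rw [hd] at h1
    exact pos_of_mul_pos_right h1 (by positivity)
  have hr0 : r 0 = 1 - (1 + c) * d := by
    have h2 : (1 + 2 * c) * r 0 = (1 + 2 * c) * (1 - (1 + c) * d) := by
      have := hs.symmetric
      rw [hd] at this
      linarith
    exact mul_left_cancel₀ (by positivity) h2
  set τ := r 0 * r 1 / (r 0 + (1 + c) * r 1) with hτ
  have hτg : τ = r 0 - 2 * (c * g) := by
    have hden : r 0 + (1 + c) * r 1 ≠ 0 := by positivity
    rw [hτ, div_eq_iff hden]
    have h3 : 2 * (c * g) = c * ((3 + 4 * c) * d - 1) := by rw [← hg]; ring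
    rw [h3]
    rw [hd, hr0] at hA ⊢
    linear_combination (-(1 + c)) * hA
  have hτ0 : 0 < τ := by positivity
  have hτ1 : τ < r 0 := by
    rw [hτ, div_lt_iff₀ (by positivity)]
    have : 0 < r 0 * r 0 + r 0 * (c * r 1) := by positivity
    linarith
  have hg0 : 0 < g := by
    have : 0 < c * g := by linarith
    exact pos_of_mul_pos_right this hc.le
  have e1 : 1 - r 0 = (1 + c) * d := by rw [hr0]; ring
  have e2 : (r 0 + τ) / 2 = r 0 - c * g := by rw [hτg]; ring
  have e3 : (r 0 - τ) / 2 = c * g := by rw [hτg]; ring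
  have e4 : (1 - r 0) / (1 + c) = d := by rw [e1]; field_simp
  have e5 : (r 0 + c) / (2 * (1 + c)) = (1 - d) / 2 := by rw [hr0]; field_simp; ring
  refine ⟨d, g, hc, hd0, hg0, hr0, hd, by rw [hs.r_symm, hd], hs.r_lt_one, hg, by linarith, ?_, ?_, ?_⟩ <;>
    · simp only [transitionMatrix, ← hτ, e2, e3, e4, e5]
      simp [e1]

/-- The right eigenvector of the transition matrix at `j = 1, 2` for the eigenvalue `r_j`. -/
def normalVec (d g : ℝ) (j : Fin 3) : Fin 3 → ℝ :=
  fun l => if l = 0 then g else if l = j then 0 else d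

/-- The right eigenvector of the transition matrix at `j = 1, 2` for the smallest eigenvalue. -/
def tangentialVec (c : ℝ) (j : Fin 3) : Fin 3 → ℝ :=
  fun l => if l = 0 then -c else if l = j then 0 else 1

/-- Otherwise `x` would be orthogonal to every left eigenvector, and these span. -/
lemma exists_eigenvalue_of_mulVec {M : Matrix (Fin 3) (Fin 3) ℝ} {β : Fin 3 → Fin 3 → ℝ}
    {lam : Fin 3 → ℝ} (hβ : LinearIndependent ℝ β)
    (h : ∀ k, Matrix.vecMul (β k) M = lam k • β k) {x : Fin 3 → ℝ} {ν : ℝ} (hx : x ≠ 0)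
    (hM : M.mulVec x = ν • x) : ∃ k, lam k = ν := by
  by_contra hne
  push Not at hne
  have h0 : ∀ k, β k ⬝ᵥ x = 0 := by
    intro k
    have e1 : β k ⬝ᵥ M.mulVec x = Matrix.vecMul (β k) M ⬝ᵥ x := Matrix.dotProduct_mulVec _ _ _
    rw [hM, h, dotProduct_smul, smul_dotProduct, smul_eq_mul, smul_eq_mul] at e1
    have e2 : (lam k - ν) * (β k ⬝ᵥ x) = 0 := by linarith
    exact (mul_eq_zero.1 e2).resolve_left (sub_ne_zero.2 (hne k))
  have hu : IsUnit (Matrix.of β) := Matrix.linearIndependent_rows_iff_isUnit.1 hβ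
  refine hx (Matrix.mulVec_injective_iff_isUnit.2 hu ?_)
  rw [Matrix.mulVec_zero]
  funext k
  exact h0 k

lemma dotProduct_eq_zero_of_ne {M : Matrix (Fin 3) (Fin 3) ℝ} {b x : Fin 3 → ℝ} {s t : ℝ}
    (hb : Matrix.vecMul b M = s • b) (hx : M.mulVec x = t • x) (hst : s ≠ t) : b ⬝ᵥ x = 0 := by
  have e1 : b ⬝ᵥ M.mulVec x = Matrix.vecMul b M ⬝ᵥ x := Matrix.dotProduct_mulVec _ _ _
  rw [hx, hb, dotProduct_smul, smul_dotProduct, smul_eq_mul, smul_eq_mul] at e1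
  have e2 : (s - t) * (b ⬝ᵥ x) = 0 := by linarith
  exact (mul_eq_zero.1 e2).resolve_left (sub_ne_zero.2 hst)

lemma linearIndependent_of_vecMul {M : Matrix (Fin 3) (Fin 3) ℝ} {β : Fin 3 → Fin 3 → ℝ}
    {lam : Fin 3 → ℝ} (h : ∀ k, Matrix.vecMul (β k) M = lam k • β k)
    (hlam : Function.Injective lam) (hβ : ∀ k, β k ≠ 0) : LinearIndependent ℝ β := by
  refine Module.End.eigenvectors_linearIndependent' (Matrix.vecMulLinear M) lam hlam β fun k => ?_
  exact Module.End.hasEigenvector_iff.2 ⟨Module.End.mem_eigenspace_iff.2 (h k), hβ k⟩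

/-! ### Eigenvectors at the two symmetric vertices -/

section Param

variable {c : ℝ} {r : Fin 3 → ℝ} {d g : ℝ}

lemma IsRenormParam.mulVec_normalVec (hp : IsRenormParam c r d g) {j : Fin 3} (hj : j ≠ 0) :
    (transitionMatrix c r j).mulVec (normalVec d g j) = r 1 • normalVec d g j := by
  have hr := hp.r_one
  have hg := hp.two_mul_g
  fin_cases j
  · exact absurd rfl hj
  · funext k
    fin_cases k <;> simp [hp.matrix_one, Matrix.mulVec, dotProduct, Fin.sum_univ_three, normalVec,
      hr]
    · ring
    · linear_combination (d / 2) * hg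
  · funext k
    fin_cases k <;> simp [hp.matrix_two, Matrix.mulVec, dotProduct, Fin.sum_univ_three, normalVec,
      hr]
    · ring
    · linear_combination (d / 2) * hg

lemma IsRenormParam.mulVec_tangentialVec (hp : IsRenormParam c r d g) {j : Fin 3} (hj : j ≠ 0) :
    (transitionMatrix c r j).mulVec (tangentialVec c j) = ((1 - r 1) / 2) • tangentialVec c j := by
  have hr := hp.r_one
  have hg := hp.two_mul_g
  fin_cases j
  · exact absurd rfl hj
  · funext k
    fin_cases k <;> simp [hp.matrix_one, Matrix.mulVec, dotProduct, Fin.sum_univ_three,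
      tangentialVec, hr]
    · linear_combination (c / 2) * hg
    · ring
  · funext k
    fin_cases k <;> simp [hp.matrix_two, Matrix.mulVec, dotProduct, Fin.sum_univ_three,
      tangentialVec, hr]
    · linear_combination (c / 2) * hg
    · ring

/-- The row of the transition matrix that relates the two nontrivial entries of an
eigenvector. -/
lemma IsRenormParam.eigenvector_entries (hp : IsRenormParam c r d g) {j k : Fin 3} (hj : j ≠ 0)
    (hk : k ≠ 0) (hjk : k ≠ j) {x : Fin 3 → ℝ} {ν : ℝ} (hν : ν ≠ 1)
    (hx : (transitionMatrix c r j).mulVec x = ν • x) :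
    x j = 0 ∧ d * x 0 = (ν - (1 - d) / 2) * x k := by
  have h1 : x j = 0 := by
    have e := congrFun hx j
    rw [transitionMatrix_corner, Pi.smul_apply, smul_eq_mul] at e
    have e2 : (1 - ν) * x j = 0 := by linarith
    exact (mul_eq_zero.1 e2).resolve_left (sub_ne_zero.2 hν.symm)
  refine ⟨h1, ?_⟩
  have e := congrFun hx k
  fin_cases j
  · exact absurd rfl hj
  · fin_cases k
    · exact absurd rfl hk
    · exact absurd rfl hjk
    · simp [hp.matrix_one, Matrix.mulVec, dotProduct, Fin.sum_univ_three] at e h1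
      rw [h1] at e
      simp
      linarith
  · fin_cases k
    · exact absurd rfl hk
    · simp [hp.matrix_two, Matrix.mulVec, dotProduct, Fin.sum_univ_three] at e h1
      rw [h1] at e
      simp
      linarith
    · exact absurd rfl hjk

lemma eq_smul_of_entries {j k : Fin 3} (hj : j ≠ 0) (hk : k ≠ 0) (hjk : k ≠ j)
    {x : Fin 3 → ℝ} {t p q : ℝ} (h0 : x 0 = t * p) (hxj : x j = 0) (hxk : x k = t * q) :
    x = t • fun l => if l = 0 then p else if l = j then 0 else q := by
  funext l
  by_cases hl : l = 0
  · simp [hl, h0]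
  by_cases hlj : l = j
  · simp [hlj, hxj, hj]
  obtain rfl : l = k := by omega
  simp [hl, hlj, hxk]

lemma IsRenormParam.normalVec_pairing (hp : IsRenormParam c r d g) :
    g + c * d = r 1 - (1 - r 1) / 2 := by
  rw [hp.r_one]; linear_combination hp.two_mul_g / 2

/-- The nondegeneracy behind the counterexample. If `g = d`, then `d = 1 / (1 + 4 * c)`, and the odd
equation reduces to `2 * c * (c - 1) = 0`. So `c = 1`, `d = 1/5`, and both ratios equal `3/5`. -/
lemma IsRenormParam.g_ne_d (hp : IsRenormParam c r d g) (hs : IsRenormSolution c r)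
    (h : r 1 / r 0 ≠ 1) : g ≠ d := by
  rintro rfl
  have hc := hp.c_pos
  have hA := hs.antisymmetric
  have hg := hp.two_mul_g
  have h4 : g * (1 + 4 * c) = 1 := by linarith
  rw [hp.r_one, hp.r_zero] at hA
  have h5 : 2 * c * (c - 1) = 0 := by
    have hgc : g = 1 / (1 + 4 * c) := by field_simp; linarith
    rw [hgc] at hA
    field_simp at hA
    linarith
  have hc1 : c = 1 := by
    have := (mul_eq_zero.1 h5).resolve_left (by positivity)
    linarith
  subst hc1
  apply h
  rw [hp.r_one, hp.r_zero]
  have : g = 1 / 5 := by linarith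
  rw [this]; norm_num

/-- The threshold `1/3` is what makes `(1 - r 1) / 2 < r 1`, so that the tangential eigenvalue is
the smallest. It follows from `r 0 + r 1 ≥ 1` and `r 1 > (3/4) * r 0`. -/
lemma IsRenormSolution.one_third_lt (hs : IsRenormSolution c r) (h : |r 1 / r 0 - 1| < 1 / 4) :
    1 / 3 < r 1 := by
  have h0 := hs.r_pos 0
  have h1 := hs.r_pos 1
  have hc := hs.c_pos
  have h2 : 3 / 4 < r 1 / r 0 := by linarith [(abs_lt.1 h).1]
  rw [lt_div_iff₀ h0] at h2
  have h3 : 1 ≤ r 0 + r 1 := by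
    have h4 : (1 + 2 * c) * 1 ≤ (1 + 2 * c) * (r 0 + r 1) := by
      have := hs.symmetric
      have : 0 < r 1 * c := by positivity
      linarith
    exact le_of_mul_le_mul_left h4 (by positivity)
  linarith

/-- The eigenvalues and eigenvectors at the two symmetric vertices. -/
structure IsSymmetricEigenData (c : ℝ) (r : Fin 3 → ℝ) (d g : ℝ) (lam : Fin 3 → Fin 3 → ℝ)
    (β α : Fin 3 → Fin 3 → Fin 3 → ℝ) (j : Fin 3) : Prop where
  lam_one : lam j 1 = r 1
  lam_two : lam j 2 = (1 - r 1) / 2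
  normal : α j 1 = (-(g + c * d)⁻¹) • normalVec d g j
  one_normal : β j 1 ⬝ᵥ normalVec d g j ≠ 0
  one_tangential : β j 1 ⬝ᵥ tangentialVec c j = 0
  two_normal : β j 2 ⬝ᵥ normalVec d g j = 0
  two_tangential : β j 2 ⬝ᵥ tangentialVec c j ≠ 0

end Param

/-! ### Uniqueness and existence of the eigendata -/

section EigenData

variable {v : Fin 3 → Plane} {φ : Fin 3 → Plane → ℝ} {c : ℝ} {r : Fin 3 → ℝ} {d g : ℝ}
  {M : Fin 3 → Matrix (Fin 3) (Fin 3) ℝ} {lam : Fin 3 → Fin 3 → ℝ}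
  {β α : Fin 3 → Fin 3 → Fin 3 → ℝ}

lemma IsEigenData.eq_transitionMatrix (h : IsEigenData v c r M lam β α)
    (hφ : IsBarycentric v φ) (hs : IsRenormSolution c r) : M = transitionMatrix c r := by
  funext j
  ext k l
  obtain ⟨f, hf, hfv⟩ := exists_harmonic hφ hs (Pi.single l 1)
  have h1 := h.transition f hf j k
  have h2 := hfv [j] k
  have h3 : ∀ i, f (v i) = (Pi.single l 1 : Fin 3 → ℝ) i := fun i => hfv [] i
  simp only [h3] at h1
  rw [cellMap_cons, cellMap_nil, h1, harmonicData_cons, harmonicData_nil] at h2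
  simpa [Pi.single_apply] using h2

lemma IsEigenData.isSymmetricEigenData (h : IsEigenData v c r M lam β α)
    (hφ : IsBarycentric v φ) (hs : IsRenormSolution c r) (hp : IsRenormParam c r d g)
    (h3 : 1 / 3 < r 1) {j : Fin 3} (hj : j ≠ 0) : IsSymmetricEigenData c r d g lam β α j := by
  have hM := h.eq_transitionMatrix hφ hs
  have hc := hp.c_pos
  have hd := hp.d_pos
  have hg := hp.g_pos
  have hr1 := hp.r_lt_one 1
  have hn := h.normal j
  have hle := h.left_eigen j
  have hre := h.right_eigen j
  rw [hM] at hle hre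
  have hn0 := hn 0
  have hn1 := hn 1
  have hn2 := hn 2
  -- The normalization of `β j 1` leaves no freedom: entry `0` of the left eigenvector equation
  -- alone determines the eigenvalue.
  have hl1 : lam j 1 = r 1 := by
    have e := congrFun (hle 1) 0
    have hr := hp.r_one
    fin_cases j
    · exact absurd rfl hj
    · simp [conductance] at hn0 hn2
      simp [hp.matrix_one, Matrix.vecMul, dotProduct, Fin.sum_univ_three, hn0, hn2] at e
      change lam 1 1 = _; linarith
    · simp [conductance] at hn0 hn1
      simp [hp.matrix_two, Matrix.vecMul, dotProduct, Fin.sum_univ_three, hn0, hn1] at e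
      change lam 2 1 = _; linarith
  have ht0 : tangentialVec c j ≠ 0 := fun e => by
    have := congrFun e 0
    simp [tangentialVec] at this
    exact hc.ne' this
  -- This eigenvalue must occur; being smaller than `r 1 = lam j 1`, the ordering leaves it only the
  -- last place.
  have hl2 : lam j 2 = (1 - r 1) / 2 := by
    obtain ⟨k, hk⟩ := exists_eigenvalue_of_mulVec (h.complete j) hle ht0
      (hp.mulVec_tangentialVec hj)
    have ho := h.ordered j (show (0 : Fin 3) ≤ 1 by decide)
    simp only [hl1] at ho
    rw [abs_of_pos (by linarith : 0 < r 1)] at ho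
    fin_cases k
    · simp only [Fin.zero_eta] at hk
      rw [hk, abs_of_pos (by linarith)] at ho
      linarith
    · simp only [Fin.mk_one] at hk
      linarith
    · exact hk
  obtain ⟨k, hk, hkj⟩ : ∃ k : Fin 3, k ≠ 0 ∧ k ≠ j := by
    clear * -
    revert j; decide
  have hpair := hp.normalVec_pairing
  have hgc : 0 < g + c * d := by positivity
  have hα : ∃ t : ℝ, α j 1 = t • normalVec d g j := by
    have e := hre 1
    rw [hl1] at e
    obtain ⟨e1, e2⟩ := hp.eigenvector_entries hj hk hkj hr1.ne e
    refine ⟨α j 1 k / d, eq_smul_of_entries hj hk hkj ?_ e1 (by field_simp)⟩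
    have : r 1 - (1 - d) / 2 = g := by rw [hp.r_one]; linear_combination -hp.two_mul_g / 2
    rw [this] at e2
    field_simp
    linarith
  have hα2 : ∃ t : ℝ, α j 2 = t • tangentialVec c j := by
    have e := hre 2
    rw [hl2] at e
    obtain ⟨e1, e2⟩ := hp.eigenvector_entries hj hk hkj (by linarith) e
    refine ⟨α j 2 k, eq_smul_of_entries hj hk hkj ?_ e1 (by simp)⟩
    have : (1 - r 1) / 2 - (1 - d) / 2 = -(c * d) := by rw [hp.r_one]; ring
    rw [this] at e2
    exact mul_left_cancel₀ hd.ne' (by linarith)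
  obtain ⟨t, ht⟩ := hα
  obtain ⟨t', ht'⟩ := hα2
  have hp1 := h.pairing j 1
  have hp2 := h.pairing j 2
  rw [ht, dotProduct_smul, smul_eq_mul] at hp1
  rw [ht', dotProduct_smul, smul_eq_mul] at hp2
  have hβn : β j 1 ⬝ᵥ normalVec d g j = -(g + c * d) := by
    fin_cases j
    · exact absurd rfl hj
    · simp [conductance] at hn0 hn2
      simp [dotProduct, Fin.sum_univ_three, hn0, hn2, normalVec]; ring
    · simp [conductance] at hn0 hn1
      simp [dotProduct, Fin.sum_univ_three, hn0, hn1, normalVec]; ring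
  refine ⟨hl1, hl2, ?_, ?_, ?_, ?_, ?_⟩
  · rw [ht]
    congr 1
    rw [hβn] at hp1
    field_simp
    linarith
  · rw [hβn]; exact (neg_neg_of_pos hgc).ne
  · refine dotProduct_eq_zero_of_ne (hle 1) (hp.mulVec_tangentialVec hj) ?_
    rw [hl1]; linarith
  · refine dotProduct_eq_zero_of_ne (hle 2) (hp.mulVec_normalVec hj) ?_
    rw [hl2]; linarith
  · exact right_ne_zero_of_mul (hp2.symm ▸ one_ne_zero)

lemma IsRenormParam.exists_isEigenData (hφ : IsBarycentric v φ) (hs : IsRenormSolution c r)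
    (hp : IsRenormParam c r d g) (h3 : 1 / 3 < r 1) :
    ∃ M lam β α, IsEigenData v c r M lam β α := by
  have hc := hp.c_pos
  have hd := hp.d_pos
  have hg := hp.g_pos
  have hcg : 0 < c * g := by positivity
  have hcd : 0 < c * d := by positivity
  have h00 := hs.r_pos 0
  have h01 := hp.r_lt_one 0
  have h11 := hp.r_lt_one 1
  have hlt := hp.lt_r_zero
  have hr0 := hp.r_zero
  have hr1 := hp.r_one
  have hr2 := hp.r_two
  have hgg := hp.two_mul_g
  -- For `j = 1, 2` both nonconstant pairings with the unscaled right eigenvectors equal `-(g + c *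
  -- d)`, so `-q` normalizes them. The third left eigenvector is chosen to annihilate the constants
  -- and the normal vector.
  obtain ⟨q, hq⟩ : ∃ q, q * (g + c * d) = 1 := ⟨(g + c * d)⁻¹, by field_simp⟩
  have hleft : ∀ j k, Matrix.vecMul
      ((![![![1, 0, 0], ![2, -1, -1], ![0, 1, -1]],
        ![![0, 1, 0], ![-1, 1 + c, -c], ![d, g - d, -g]],
        ![![0, 0, 1], ![-1, -c, 1 + c], ![d, -g, g - d]]] : Fin 3 → Fin 3 → Fin 3 → ℝ) j k)
      (transitionMatrix c r j) =
      ((![![1, r 0, r 0 - 2 * (c * g)], ![1, r 1, (1 - r 1) / 2],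
        ![1, r 1, (1 - r 1) / 2]] : Fin 3 → Fin 3 → ℝ) j k) •
      ((![![![1, 0, 0], ![2, -1, -1], ![0, 1, -1]],
        ![![0, 1, 0], ![-1, 1 + c, -c], ![d, g - d, -g]],
        ![![0, 0, 1], ![-1, -c, 1 + c], ![d, -g, g - d]]] : Fin 3 → Fin 3 → Fin 3 → ℝ) j k) := by
    intro j k
    funext l
    obtain rfl : g = ((3 + 4 * c) * d - 1) / 2 := by linarith
    fin_cases j <;> fin_cases k <;> fin_cases l <;>
      simp [hp.matrix_zero, hp.matrix_one, hp.matrix_two, Matrix.vecMul, dotProduct,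
        Fin.sum_univ_three, hr0, hr1] <;> ring
  refine ⟨transitionMatrix c r, ![![1, r 0, r 0 - 2 * (c * g)], ![1, r 1, (1 - r 1) / 2],
      ![1, r 1, (1 - r 1) / 2]],
    ![![![1, 0, 0], ![2, -1, -1], ![0, 1, -1]],
      ![![0, 1, 0], ![-1, 1 + c, -c], ![d, g - d, -g]],
      ![![0, 0, 1], ![-1, -c, 1 + c], ![d, -g, g - d]]],
    ![![![1, 1, 1], ![0, -1 / 2, -1 / 2], ![0, 1 / 2, -1 / 2]],
      ![![1, 1, 1], ![-q * g, 0, -q * d], ![-q * -c, 0, -q * 1]],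
      ![![1, 1, 1], ![-q * g, -q * d, 0], ![-q * -c, -q * 1, 0]]], ?_, hleft, ?_, ?_, ?_, ?_, ?_, ?_⟩
  · intro h hh j k
    have := hh.hasHarmonicValues hφ hs [j] k
    exact this
  · intro j
    refine linearIndependent_of_vecMul (hleft j) ?_ ?_
    · intro k l hkl
      fin_cases j <;> fin_cases k <;> fin_cases l <;> simp at hkl ⊢ <;>
        first | linarith | (rcases hkl with hkl | hkl <;> linarith)
    · intro k e
      have e0 := congrFun e 0
      have e1 := congrFun e 1
      have e2 := congrFun e 2
      fin_cases j <;> fin_cases k <;> simp at e0 e1 e2 <;> linarith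
  · intro j k
    fin_cases j <;> fin_cases k <;> simp <;> intro h <;> linarith
  · intro j
    refine Fin.antitone_iff_succ_le.2 fun k => ?_
    fin_cases j <;> fin_cases k <;> simp <;>
      first
      | (rw [abs_of_pos (by linarith)]; linarith)
      | (rw [abs_of_pos (by linarith), abs_of_pos (by linarith)]; linarith)
  · intro j k
    obtain rfl : g = ((3 + 4 * c) * d - 1) / 2 := by linarith
    funext l
    fin_cases j <;> fin_cases k <;> fin_cases l <;>
      simp [hp.matrix_zero, hp.matrix_one, hp.matrix_two, Matrix.mulVec, dotProduct,
        Fin.sum_univ_three, hr0, hr1] <;> ring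
  · intro j k
    fin_cases j <;> fin_cases k <;> simp [dotProduct, Fin.sum_univ_three] <;>
      first | norm_num; done | linear_combination hq
  · intro j l
    fin_cases j <;> fin_cases l <;> simp [conductance, Fin.sum_univ_three]; norm_num

end EigenData

/-! ### Harmonic functions and approximants near the junction point -/

section Junction

variable {v : Fin 3 → Plane} {φ : Fin 3 → Plane → ℝ} {c : ℝ} {r : Fin 3 → ℝ} {d g : ℝ}

lemma nbhdCells_zero : nbhdCells [] 1 2 0 = {[1], [2]} := rfl

lemma nbhd_subset_gasket : nbhd v [] 1 2 0 ⊆ gasket v := by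
  intro p hp
  simp only [nbhd, cellUnion, mem_iUnion] at hp
  obtain ⟨w, -, y, hy, rfl⟩ := hp
  exact cellMap_mem_gasket v w hy

lemma vertex_mem_nbhd (w : List (Fin 3)) (l : Fin 3) :
    sgMap v 1 (cellMap v w (v l)) ∈ nbhd v [] 1 2 0 ∧
      sgMap v 2 (cellMap v w (v l)) ∈ nbhd v [] 1 2 0 := by
  have h := cellMap_mem_gasket v w (vertex_mem_gasket v l)
  simp only [nbhd, cellUnion, mem_iUnion]
  exact ⟨⟨[1], by simp [nbhdCells_zero], _, h, rfl⟩, ⟨[2], by simp [nbhdCells_zero], _, h, rfl⟩⟩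

lemma localEnergy_nbhdCells_zero (m : ℕ) (u : Plane → ℝ) :
    localEnergy v c r (nbhdCells [] 1 2 0) m u =
      (r 1)⁻¹ * energy v c r m (fun x => u (sgMap v 1 x)) +
        (r 2)⁻¹ * energy v c r m fun x => u (sgMap v 2 x) := by
  rw [nbhdCells_zero, localEnergy, Finset.sum_pair (by decide)]
  simp [cellRatio, cellMap_cons]

lemma mem_nbhdBoundary_left {m : ℕ} {l : Fin 3} (hl : l ≠ 2) :
    sgMap v 1 (cellMap v (List.replicate m 2) (v l)) ∈ nbhdBoundary v [] 1 2 m :=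
  Or.inl ⟨l, hl, rfl⟩

lemma mem_nbhdBoundary_right {m : ℕ} {l : Fin 3} (hl : l ≠ 1) :
    sgMap v 2 (cellMap v (List.replicate m 1) (v l)) ∈ nbhdBoundary v [] 1 2 m :=
  Or.inr ⟨l, hl, rfl⟩

/-- Harmonic functions near the junction are made of two harmonic functions with balanced
normal derivatives. -/
lemma exists_harmonicOn_nbhd (hφ : IsBarycentric v φ) (hs : IsRenormSolution c r)
    {t t' : Fin 3 → ℝ} (hx : t 2 = t' 1)
    (hflux : t 2 - t 0 + c * (t 2 - t 1) + (t' 1 - t' 0 + c * (t' 1 - t' 2)) = 0) :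
    ∃ T, IsHarmonicOn v c r (nbhdCells [] 1 2 0) (nbhdBoundary v [] 1 2 0) T ∧
      HasHarmonicValues v c r t (fun x => T (sgMap v 1 x)) ∧
      HasHarmonicValues v c r t' (fun x => T (sgMap v 2 x)) := by
  -- The data on `F_1 K` are irrelevant to `U_0(x)`; they only complete a continuous gluing on the
  -- whole gasket.
  obtain ⟨T, hT, hTv⟩ := exists_piecewise_harmonic hφ hs ![![0, t 0, t' 0], t, t'] (by
    intro i j
    fin_cases i <;> fin_cases j <;> simp [hx])
  have h1 : HasHarmonicValues v c r t (fun x => T (sgMap v 1 x)) := hTv 1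
  have h2 : HasHarmonicValues v c r t' (fun x => T (sgMap v 2 x)) := hTv 2
  refine ⟨T, ⟨hT.mono nbhd_subset_gasket, fun m u hu => ?_⟩, h1, h2⟩
  rw [localEnergy_nbhdCells_zero, localEnergy_nbhdCells_zero, h1.energy_eq hs, h2.energy_eq hs]
  have hb := hs.isBilateralStructure hφ
  have hr := hs.r_pos 1
  have e1 := hb.baseEnergy_le_energy m fun x => u (sgMap v 1 x)
  have e2 := hb.baseEnergy_le_energy m fun x => u (sgMap v 2 x)
  rw [hs.r_symm, ← mul_add, ← mul_add]
  refine mul_le_mul_of_nonneg_left (le_trans ?_ (add_le_add e1 e2)) (inv_nonneg.2 hr.le)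
  have u1 : ∀ l : Fin 3, l ≠ 2 → u (sgMap v 1 (v l)) = t l := fun l hl =>
    (hu (mem_nbhdBoundary_left (m := 0) hl)).trans (h1 [] l)
  have u2 : ∀ l : Fin 3, l ≠ 1 → u (sgMap v 2 (v l)) = t' l := fun l hl =>
    (hu (mem_nbhdBoundary_right (m := 0) hl)).trans (h2 [] l)
  simp only [baseEnergy, u1 0 (by decide), u1 1 (by decide), u2 0 (by decide), u2 2 (by decide),
    sgMap_comm v 2 1]
  have hc := hs.c_pos
  set x := u (sgMap v 1 (v 2))
  rw [← hx] at hflux ⊢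
  have : 0 ≤ (2 + 2 * c) * (x - t 2) ^ 2 := by positivity
  -- As a function of the free value at the junction, the energy is quadratic; the flux condition
  -- removes the linear term around `t 2`.
  linear_combination this - 2 * (x - t 2) * hflux

lemma IsHarmonicOn.nbhd_values {T : Plane → ℝ}
    (hT : IsHarmonicOn v c r (nbhdCells [] 1 2 0) (nbhdBoundary v [] 1 2 0) T)
    (hφ : IsBarycentric v φ) (hs : IsRenormSolution c r) :
    ∃ t t' : Fin 3 → ℝ, t 2 = t' 1 ∧
      t 2 - t 0 + c * (t 2 - t 1) + (t' 1 - t' 0 + c * (t' 1 - t' 2)) = 0 ∧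
      HasHarmonicValues v c r t (fun x => T (sgMap v 1 x)) ∧
      HasHarmonicValues v c r t' (fun x => T (sgMap v 2 x)) := by
  have hc := hs.c_pos
  set p := fun l => T (sgMap v 1 (v l)) with hp
  set q := fun l => T (sgMap v 2 (v l)) with hq
  -- The junction value that balances the fluxes for the given four boundary values.
  let ξ := (p 0 + c * p 1 + q 0 + c * q 2) / (2 + 2 * c)
  have hξ : ξ * (2 + 2 * c) = p 0 + c * p 1 + q 0 + c * q 2 := by simp only [ξ]; field_simp
  have hfl : ξ - p 0 + c * (ξ - p 1) + (ξ - q 0 + c * (ξ - q 2)) = 0 := by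
    linear_combination hξ
  obtain ⟨T', hT', h1, h2⟩ := exists_harmonicOn_nbhd (t := ![p 0, p 1, ξ]) (t' := ![q 0, ξ, q 2])
    hφ hs rfl hfl
  have hkey := (hs.isBilateralStructure hφ).eq_of_isHarmonicOn hT hT' (by
    rintro _ (⟨l, hl, rfl⟩ | ⟨l, hl, rfl⟩)
    · refine Eq.trans ?_ (h1 [] l).symm
      fin_cases l
      · rfl
      · rfl
      · exact absurd rfl hl
    · refine Eq.trans ?_ (h2 [] l).symm
      fin_cases l
      · rfl
      · exact absurd rfl hl
      · rfl) (by
    intro w hw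
    rw [nbhdCells_zero, Finset.mem_insert, Finset.mem_singleton] at hw
    rcases hw with rfl | rfl
    · exact ⟨0, mem_nbhdBoundary_left (m := 0) (by decide)⟩
    · exact ⟨0, mem_nbhdBoundary_right (m := 0) (by decide)⟩)
  refine ⟨![p 0, p 1, ξ], ![q 0, ξ, q 2], rfl, hfl, fun w i => ?_, fun w i => ?_⟩
  · rw [← h1]; exact hkey.1 [1] (by simp [nbhdCells_zero]) w i
  · rw [← h2]; exact hkey.1 [2] (by simp [nbhdCells_zero]) w i

lemma eqOn_nbhd {T T' : Plane → ℝ} {t t' : Fin 3 → ℝ}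
    (hT : ContinuousOn T (nbhd v [] 1 2 0)) (hT' : ContinuousOn T' (nbhd v [] 1 2 0))
    (h1 : HasHarmonicValues v c r t (fun x => T (sgMap v 1 x)))
    (h2 : HasHarmonicValues v c r t' (fun x => T (sgMap v 2 x)))
    (h1' : HasHarmonicValues v c r t (fun x => T' (sgMap v 1 x)))
    (h2' : HasHarmonicValues v c r t' (fun x => T' (sgMap v 2 x))) :
    EqOn T T' (nbhd v [] 1 2 0) := by
  refine eqOn_cellUnion hT hT' fun w hw w' i => ?_
  rw [nbhdCells_zero, Finset.mem_insert, Finset.mem_singleton] at hw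
  rcases hw with rfl | rfl
  · exact (h1 w' i).trans (h1' w' i).symm
  · exact (h2 w' i).trans (h2' w' i).symm

/-- The combination of the three eigenvectors at `j` with the given coefficients. -/
noncomputable def eigenComb (c d g : ℝ) (j : Fin 3) (ξ P Q : ℝ) : Fin 3 → ℝ :=
  ξ • 1 + P • normalVec d g j + Q • tangentialVec c j

lemma eigenComb_zero {j : Fin 3} (ξ P Q : ℝ) : eigenComb c d g j ξ P Q 0 = ξ + P * g - Q * c := by
  simp [eigenComb, normalVec, tangentialVec]; ring

lemma eigenComb_self {j : Fin 3} (hj : j ≠ 0) (ξ P Q : ℝ) : eigenComb c d g j ξ P Q j = ξ := by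
  simp [eigenComb, normalVec, tangentialVec, hj]

lemma eigenComb_other {j k : Fin 3} (hk : k ≠ 0) (hkj : k ≠ j) (ξ P Q : ℝ) :
    eigenComb c d g j ξ P Q k = ξ + P * d + Q := by
  simp [eigenComb, normalVec, tangentialVec, hk, hkj]

lemma IsRenormParam.exists_eigenComb (hp : IsRenormParam c r d g) {j : Fin 3} (hj : j ≠ 0)
    (t : Fin 3 → ℝ) : ∃ P Q, t = eigenComb c d g j (t j) P Q := by
  have hc := hp.c_pos
  have hd := hp.d_pos
  have hg := hp.g_pos
  obtain ⟨k, hk, hkj⟩ : ∃ k : Fin 3, k ≠ 0 ∧ k ≠ j := by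
    clear * -
    revert j; decide
  have hne : g + c * d ≠ 0 := by positivity
  refine ⟨(t 0 - t j + c * (t k - t j)) / (g + c * d),
    t k - t j - (t 0 - t j + c * (t k - t j)) / (g + c * d) * d, ?_⟩
  funext l
  by_cases hl : l = 0
  · rw [hl, eigenComb_zero]; field_simp; ring
  by_cases hlj : l = j
  · rw [hlj, eigenComb_self hj]
  obtain rfl : l = k := by omega
  rw [eigenComb_other hk hkj]; ring

lemma IsRenormParam.harmonicData_eigenComb (hp : IsRenormParam c r d g)
    (hs : IsRenormSolution c r) {j : Fin 3} (hj : j ≠ 0) (m : ℕ) (ξ P Q : ℝ) :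
    harmonicData c r (List.replicate m j) (eigenComb c d g j ξ P Q) =
      eigenComb c d g j ξ (P * r 1 ^ m) (Q * ((1 - r 1) / 2) ^ m) := by
  have h1 : (transitionMatrix c r j).mulVec 1 = (1 : ℝ) • (1 : Fin 3 → ℝ) := by
    funext k
    have := (hs.stochastic j k).2.2
    simpa [Matrix.mulVec, dotProduct] using this
  simp only [eigenComb, harmonicData_add, harmonicData_smul, harmonicData_replicate h1,
    harmonicData_replicate (hp.mulVec_normalVec hj),
    harmonicData_replicate (hp.mulVec_tangentialVec hj), smul_smul, one_pow, mul_one]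

/-- The constant and tangential vectors carry no flux, and the normal vector carries `-(g + c * d)`,
so the total is `-(g + c * d) * (P + P')`. -/
lemma IsRenormParam.balance_iff (hp : IsRenormParam c r d g) {ξ P Q P' Q' : ℝ} :
    (let t := eigenComb c d g 2 ξ P Q
     let t' := eigenComb c d g 1 ξ P' Q'
     t 2 - t 0 + c * (t 2 - t 1) + (t' 1 - t' 0 + c * (t' 1 - t' 2)) = 0) ↔ P' = -P := by
  have hc := hp.c_pos
  have hd := hp.d_pos
  have hg := hp.g_pos
  have hne : g + c * d ≠ 0 := by positivity
  simp only [eigenComb_zero, eigenComb_self (by decide : (1 : Fin 3) ≠ 0),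
    eigenComb_self (by decide : (2 : Fin 3) ≠ 0),
    eigenComb_other (by decide : (1 : Fin 3) ≠ 0) (by decide : (1 : Fin 3) ≠ 2),
    eigenComb_other (by decide : (2 : Fin 3) ≠ 0) (by decide : (2 : Fin 3) ≠ 1)]
  constructor
  · intro h
    have : (g + c * d) * (P + P') = 0 := by linarith
    linarith [(mul_eq_zero.1 this).resolve_left hne]
  · rintro rfl
    ring

lemma IsHarmonicOn.nbhd_eigenComb {T : Plane → ℝ}
    (hT : IsHarmonicOn v c r (nbhdCells [] 1 2 0) (nbhdBoundary v [] 1 2 0) T)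
    (hφ : IsBarycentric v φ) (hs : IsRenormSolution c r) (hp : IsRenormParam c r d g) :
    ∃ ξ P Q Q', HasHarmonicValues v c r (eigenComb c d g 2 ξ P Q) (fun x => T (sgMap v 1 x)) ∧
      HasHarmonicValues v c r (eigenComb c d g 1 ξ (-P) Q') (fun x => T (sgMap v 2 x)) := by
  obtain ⟨t, t', hx, hfl, h1, h2⟩ := hT.nbhd_values hφ hs
  obtain ⟨P, Q, ht⟩ := hp.exists_eigenComb (j := 2) (by decide) t
  obtain ⟨P', Q', ht'⟩ := hp.exists_eigenComb (j := 1) (by decide) t'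
  rw [← hx] at ht'
  refine ⟨t 2, P, Q, Q', ht ▸ h1, ?_⟩
  have : P' = -P := by
    rw [← hp.balance_iff (ξ := t 2) (Q := Q) (Q' := Q')]
    simp only [← ht, ← ht']
    exact hfl
  rw [← this, ← ht']
  exact h2

lemma IsRenormParam.exists_harmonicOn_eigenComb (hp : IsRenormParam c r d g)
    (hφ : IsBarycentric v φ) (hs : IsRenormSolution c r) (ξ P Q Q' : ℝ) :
    ∃ T, IsHarmonicOn v c r (nbhdCells [] 1 2 0) (nbhdBoundary v [] 1 2 0) T ∧
      HasHarmonicValues v c r (eigenComb c d g 2 ξ P Q) (fun x => T (sgMap v 1 x)) ∧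
      HasHarmonicValues v c r (eigenComb c d g 1 ξ (-P) Q') (fun x => T (sgMap v 2 x)) := by
  refine exists_harmonicOn_nbhd hφ hs ?_ (hp.balance_iff.2 rfl)
  rw [eigenComb_self (by decide), eigenComb_self (by decide)]

/-- The restrictions of the approximant to the two cells, if the approximated function is `κ`
times the normal eigenvector on one half of the boundary of `U_m(x)` and zero on the other. -/
noncomputable def approximantData (c : ℝ) (r : Fin 3 → ℝ) (d g κ : ℝ) (m : ℕ) (j : Fin 3) (s : ℝ) : Fin 3 → ℝ :=
  eigenComb c d g j (κ / 2 * (d - (d - g) / (1 + c))) (s * (κ / 2 / r 1 ^ m))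
    (κ / 2 * ((d - g) / (1 + c)) / ((1 - r 1) / 2) ^ m)

variable {f : Plane → ℝ} {m : ℕ} {κ : ℝ}

lemma IsRenormParam.exists_approximant (hp : IsRenormParam c r d g) (hφ : IsBarycentric v φ)
    (hs : IsRenormSolution c r)
    (hf1 : ∀ l, l ≠ 2 → f (cellMap v (1 :: List.replicate m 2) (v l)) = κ * normalVec d g 2 l)
    (hf2 : ∀ l, l ≠ 1 → f (cellMap v (2 :: List.replicate m 1) (v l)) = 0) :
    ∃ h, IsApproximant v c r f [] 1 2 m h := by
  have hc := hp.c_pos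
  have hr0 := (hs.r_pos 1).ne'
  have hμ0 : (1 - r 1) / 2 ≠ 0 := by have := hp.r_lt_one 1; linarith
  obtain ⟨T, hT, h1, h2⟩ := hp.exists_harmonicOn_eigenComb hφ hs
    (κ / 2 * (d - (d - g) / (1 + c))) (1 * (κ / 2 / r 1 ^ m))
    (κ / 2 * ((d - g) / (1 + c)) / ((1 - r 1) / 2) ^ m)
    (κ / 2 * ((d - g) / (1 + c)) / ((1 - r 1) / 2) ^ m)
  refine ⟨T, hT, ?_⟩
  rintro _ (⟨l, hl, rfl⟩ | ⟨l, hl, rfl⟩)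
  · refine Eq.trans ?_ (hf1 l hl).symm
    refine (h1 _ l).trans ?_
    rw [hp.harmonicData_eigenComb hs (by decide)]
    obtain rfl | rfl : l = 0 ∨ l = 1 := by omega
    · rw [eigenComb_zero]; simp [normalVec]; field_simp; ring
    · rw [eigenComb_other (by decide) (by decide)]; simp [normalVec]; field_simp; ring
  · refine Eq.trans ?_ (hf2 l hl).symm
    refine (h2 _ l).trans ?_
    rw [hp.harmonicData_eigenComb hs (by decide)]
    obtain rfl | rfl : l = 0 ∨ l = 2 := by omega
    · rw [eigenComb_zero]; field_simp; ring
    · rw [eigenComb_other (by decide) (by decide)]; field_simp; ring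

/-- The four conditions on the boundary of `U_m(x)` form a nonsingular linear system for `ξ` and the
coefficients scaled to level `m`. -/
lemma IsApproximant.values {h : Plane → ℝ} (hh : IsApproximant v c r f [] 1 2 m h)
    (hφ : IsBarycentric v φ) (hs : IsRenormSolution c r) (hp : IsRenormParam c r d g)
    (hf1 : ∀ l, l ≠ 2 → f (cellMap v (1 :: List.replicate m 2) (v l)) = κ * normalVec d g 2 l)
    (hf2 : ∀ l, l ≠ 1 → f (cellMap v (2 :: List.replicate m 1) (v l)) = 0) :
    HasHarmonicValues v c r (approximantData c r d g κ m 2 1) (fun x => h (sgMap v 1 x)) ∧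
      HasHarmonicValues v c r (approximantData c r d g κ m 1 (-1)) (fun x => h (sgMap v 2 x)) := by
  have hc := hp.c_pos
  have hd := hp.d_pos
  have hg := hp.g_pos
  have hr0 := (hs.r_pos 1).ne'
  have hμ0 : (1 - r 1) / 2 ≠ 0 := by have := hp.r_lt_one 1; linarith
  obtain ⟨ξ, P, Q, Q', h1, h2⟩ := hh.1.nbhd_eigenComb hφ hs hp
  have e1 := fun l hl => (h1 (List.replicate m 2) l).symm.trans
    ((hh.2 (mem_nbhdBoundary_left hl)).trans (hf1 l hl))
  have e2 := fun l hl => (h2 (List.replicate m 1) l).symm.trans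
    ((hh.2 (mem_nbhdBoundary_right hl)).trans (hf2 l hl))
  have e10 := e1 0 (by decide)
  have e11 := e1 1 (by decide)
  have e20 := e2 0 (by decide)
  have e22 := e2 2 (by decide)
  rw [hp.harmonicData_eigenComb hs (by decide), eigenComb_zero] at e10 e20
  rw [hp.harmonicData_eigenComb hs (by decide), eigenComb_other (by decide) (by decide)] at e11 e22
  simp [normalVec] at e10 e11
  set p := P * r 1 ^ m with hpP
  set q := Q * ((1 - r 1) / 2) ^ m with hqQ
  set q' := Q' * ((1 - r 1) / 2) ^ m with hqQ'
  rw [neg_mul, ← hpP] at e20 e22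
  -- The weights `1` and `c` eliminate the tangential terms, and the difference of the two sides
  -- eliminates `ξ`.
  have k1 : (g + c * d) * (2 * p - κ) = 0 := by linear_combination e10 - e20 + c * (e11 - e22)
  have k2 : 2 * p - κ = 0 := (mul_eq_zero.1 k1).resolve_left (by positivity)
  have k3 : q = q' := by linear_combination e11 - e22 - d * k2
  have k4 : q * (1 + c) = κ / 2 * (d - g) := by
    linear_combination e11 - e10 - (d - g) / 2 * k2
  have k5 : q = κ / 2 * ((d - g) / (1 + c)) := by field_simp; linarith
  have k6 : ξ = κ / 2 * (d - (d - g) / (1 + c)) := by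
    rw [mul_sub, ← k5]; linear_combination e11 - d / 2 * k2
  have k7 : P = κ / 2 / r 1 ^ m := by
    rw [eq_div_iff (pow_ne_zero _ hr0), ← hpP]; linarith
  have k8 : Q = κ / 2 * ((d - g) / (1 + c)) / ((1 - r 1) / 2) ^ m := by
    rw [eq_div_iff (pow_ne_zero _ hμ0), ← hqQ, k5]
  have k9 : Q' = κ / 2 * ((d - g) / (1 + c)) / ((1 - r 1) / 2) ^ m := by
    rw [eq_div_iff (pow_ne_zero _ hμ0), ← hqQ', ← k3, k5]
  rw [approximantData, approximantData, ← k6, ← k7, one_mul, neg_one_mul, ← k8]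
  refine ⟨h1, ?_⟩
  rw [k8, ← k9]
  exact h2

/-- The value of the approximants at `F_2 v_2` is unbounded. -/
lemma tendsto_approximantData (hp : IsRenormParam c r d g) (hs : IsRenormSolution c r)
    (hgd : g ≠ d) {κ₀ η : ℝ} (hκ : κ₀ ≠ 0) (h1 : (1 - r 1) / 2 < η) (h2 : η < r 1) :
    Tendsto (fun m => |approximantData c r d g (η ^ m * κ₀) m 2 1 1|) atTop atTop := by
  have hc := hp.c_pos
  have hr0 := hs.r_pos 1
  have hr1 := hp.r_lt_one 1
  have hμ0 : 0 < (1 - r 1) / 2 := by linarith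
  have hη0 : 0 < η := by linarith
  set δ := (d - g) / (1 + c) with hδ
  have hδ0 : δ ≠ 0 := div_ne_zero (sub_ne_zero.2 hgd.symm) (by positivity)
  -- Only the tangential term grows, with ratio `η / μ > 1`; the value at the junction and the
  -- normal term have ratios `η < 1` and `η / r 1 < 1` and stay bounded.
  have key : ∀ m, |κ₀ / 2 * δ| * (η / ((1 - r 1) / 2)) ^ m -
      (|κ₀ / 2 * (d - δ)| + |κ₀ / 2 * d|) ≤
      |approximantData c r d g (η ^ m * κ₀) m 2 1 1| := by
    intro m
    have e : approximantData c r d g (η ^ m * κ₀) m 2 1 1 =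
        κ₀ / 2 * δ * (η / ((1 - r 1) / 2)) ^ m + (κ₀ / 2 * (d - δ) * η ^ m +
          κ₀ / 2 * d * (η / r 1) ^ m) := by
      rw [approximantData, eigenComb_other (by decide) (by decide), ← hδ]
      generalize (1 - r 1) / 2 = μ
      rw [div_pow, div_pow]
      ring
    have e1 : |κ₀ / 2 * (d - δ) * η ^ m| ≤ |κ₀ / 2 * (d - δ)| := by
      rw [abs_mul, abs_of_pos (pow_pos hη0 m)]
      exact mul_le_of_le_one_right (abs_nonneg _) (pow_le_one₀ hη0.le (by linarith))
    have e2 : |κ₀ / 2 * d * (η / r 1) ^ m| ≤ |κ₀ / 2 * d| := by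
      rw [abs_mul, abs_of_pos (by positivity : 0 < (η / r 1) ^ m)]
      exact mul_le_of_le_one_right (abs_nonneg _)
        (pow_le_one₀ (by positivity) ((div_le_one hr0).2 h2.le))
    have e3 : |κ₀ / 2 * δ * (η / ((1 - r 1) / 2)) ^ m| =
        |κ₀ / 2 * δ| * (η / ((1 - r 1) / 2)) ^ m := by
      rw [abs_mul, abs_of_pos (by positivity : 0 < (η / ((1 - r 1) / 2)) ^ m)]
    have e4 := abs_add_le (κ₀ / 2 * (d - δ) * η ^ m) (κ₀ / 2 * d * (η / r 1) ^ m)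
    have e5 := abs_sub_abs_le_abs_add (κ₀ / 2 * δ * (η / ((1 - r 1) / 2)) ^ m)
      (κ₀ / 2 * (d - δ) * η ^ m + κ₀ / 2 * d * (η / r 1) ^ m)
    rw [← e, e3] at e5
    linarith
  refine tendsto_atTop_mono key (tendsto_atTop_add_const_right _ _ ?_)
  exact (tendsto_pow_atTop_atTop_of_one_lt ((one_lt_div hμ0).2 h1)).const_mul_atTop
    (abs_pos.2 (by positivity))

end Junction

/-! ### The self-similar example function -/

section Example

variable {v : Fin 3 → Plane} {φ : Fin 3 → Plane → ℝ} {c : ℝ} {r : Fin 3 → ℝ} {η : ℝ}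

/-- The values on the cell `F_2 K` of the example function, which is self-similar there. -/
noncomputable def selfSimilarData (c : ℝ) (r : Fin 3 → ℝ) (η : ℝ) (b₀ b₁ : Fin 3 → ℝ) :
    List (Fin 3) → Fin 3 → ℝ
  | [] => ![b₀ 0, b₁ 1, 0]
  | i :: w => ![harmonicData c r w b₀, harmonicData c r w b₁,
      η • selfSimilarData c r η b₀ b₁ w] i

lemma selfSimilarData_replicate (b₀ b₁ : Fin 3 → ℝ) (m : ℕ) :
    selfSimilarData c r η b₀ b₁ (List.replicate m 2) = η ^ m • ![b₀ 0, b₁ 1, 0] := by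
  induction m with
  | zero => simp [selfSimilarData]
  | succ m ih =>
    rw [List.replicate_succ, selfSimilarData, pow_succ', mul_smul, ← ih]; rfl

lemma isVertexData_selfSimilarData (hs : IsRenormSolution c r) (hη : |η| < 1)
    {b₀ b₁ : Fin 3 → ℝ} (h : b₀ 1 = b₁ 0) (h0 : b₀ 2 = η * b₀ 0) (h1 : b₁ 2 = η * b₁ 1) :
    IsVertexData (selfSimilarData c r η b₀ b₁) := by
  refine IsVertexData.of_children (fun i => ?_) (fun j => ?_) fun i j => ?_
  · fin_cases i
    · exact Or.inl (hs.isVertexData b₀)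
    · exact Or.inl (hs.isVertexData b₁)
    · exact Or.inr ⟨η, hη, fun w k => rfl⟩
  · fin_cases j <;> simp [selfSimilarData]
  · fin_cases i <;> fin_cases j <;> simp [selfSimilarData, h, h0, h1]

/-- The self-similar data minimize the energy for the given values at the nodes. -/
lemma energy_selfSimilar_le (hφ : IsBarycentric v φ) (hs : IsRenormSolution c r)
    {b₀ b₁ : Fin 3 → ℝ} (h : b₀ 1 = b₁ 0) (h0 : b₀ 2 = η * b₀ 0) (h1 : b₁ 2 = η * b₁ 1)
    (hmin : (r 0)⁻¹ * (b₀ 1 - b₀ 0 + c * (b₀ 1 - b₀ 2)) +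
      (r 1)⁻¹ * (b₁ 0 - b₁ 1 + (b₁ 0 - b₁ 2)) = 0)
    (m : ℕ) (t : ℝ) (f u : Plane → ℝ)
    (hf : ∀ w i, f (cellMap v w (v i)) = t * selfSimilarData c r η b₀ b₁ w i)
    (hu : ∀ k j, u (cellMap v (List.replicate k 2) (v j)) =
      t * (η ^ k * ![b₀ 0, b₁ 1, 0] j)) :
    energy v c r m f ≤ energy v c r m u := by
  induction m generalizing t f u with
  | zero =>
    rw [energy_zero, energy_zero]
    refine le_of_eq (congrArg _ (funext fun i => (hf [] i).trans ((hu 0 i).trans ?_).symm))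
    simp [selfSimilarData]
  | succ m ih =>
    have hb := hs.isBilateralStructure hφ
    have hf0 : HasHarmonicValues v c r (t • b₀) fun x => f (sgMap v 0 x) := fun w i => by
      rw [harmonicData_smul]; exact hf (0 :: w) i
    have hf1 : HasHarmonicValues v c r (t • b₁) fun x => f (sgMap v 1 x) := fun w i => by
      rw [harmonicData_smul]; exact hf (1 :: w) i
    have e0 := hb.baseEnergy_le_energy m fun x => u (sgMap v 0 x)
    have e1 := hb.baseEnergy_le_energy m fun x => u (sgMap v 1 x)
    -- The last cell repeats the problem scaled by `η`, which is why the statement carries the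
    -- factor `t`. In the other two cells only the value at their common vertex is free, and `hmin`
    -- is its stationarity.
    have e2 := ih (t * η) (fun x => f (sgMap v 2 x)) (fun x => u (sgMap v 2 x))
      (fun w i => (hf (2 :: w) i).trans (by simp [selfSimilarData, mul_assoc]))
      (fun k j => (hu (k + 1) j).trans (by rw [pow_succ]; ring))
    have hr0 := inv_pos.2 (hs.r_pos 0)
    have hr1 := inv_pos.2 (hs.r_pos 1)
    have hr2 := inv_pos.2 (hs.r_pos 2)
    have u00 : u (v 0) = t * b₀ 0 := by simpa using hu 0 0
    have u01 : u (v 1) = t * b₁ 1 := by simpa using hu 0 1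
    have u10 : u (sgMap v 2 (v 0)) = t * (η * b₀ 0) := by simpa [cellMap] using hu 1 0
    have u11 : u (sgMap v 2 (v 1)) = t * (η * b₁ 1) := by simpa [cellMap] using hu 1 1
    simp only [baseEnergy, sgMap_self, sgMap_comm v 1 0, sgMap_comm v 0 2, sgMap_comm v 1 2, u00,
      u01, u10, u11, ← h0, ← h1] at e0 e1
    rw [energy_succ, energy_succ, Fin.sum_univ_three, Fin.sum_univ_three, hf0.energy_eq hs,
      hf1.energy_eq hs]
    refine add_le_add (le_trans ?_ (add_le_add (mul_le_mul_of_nonneg_left e0 hr0.le)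
      (mul_le_mul_of_nonneg_left e1 hr1.le))) (mul_le_mul_of_nonneg_left e2 hr2.le)
    simp only [baseEnergy, Pi.smul_apply, smul_eq_mul]
    set x := u (sgMap v 0 (v 1))
    have hc := hs.c_pos
    have : 0 ≤ ((r 0)⁻¹ * (1 + c) + (r 1)⁻¹ * 2) * (x - t * b₁ 0) ^ 2 := by positivity
    rw [h] at hmin ⊢
    linear_combination this - 2 * t * (x - t * b₁ 0) * hmin

variable {α : Fin 3 → Fin 3 → Fin 3 → ℝ}

/-- The example function exists and vanishes on `F_3 K`. -/
lemma exists_isExampleFunction (hφ : IsBarycentric v φ) (hs : IsRenormSolution c r)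
    (hη : |η| < 1) : ∃ f, IsExampleFunction v c r α η f ∧
      ∀ w i, f (cellMap v (2 :: w) (v i)) = 0 := by
  have hr0 := hs.r_pos 0
  have hr1 := hs.r_pos 1
  have hc := hs.c_pos
  set a₀ := α 2 1 0 with ha₀
  set a₁ := α 2 1 1 with ha₁
  -- The value at `F_2 F_1 v_2`, the only free vertex joining the two harmonic pieces, determined by
  -- balance of fluxes.
  obtain ⟨q, hq⟩ : ∃ q, (r 0)⁻¹ * (q - a₀ + c * (q - η * a₀)) +
      (r 1)⁻¹ * (q - a₁ + (q - η * a₁)) = 0 := by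
    refine ⟨((r 0)⁻¹ * (a₀ + c * (η * a₀)) + (r 1)⁻¹ * (a₁ + η * a₁)) /
      ((r 0)⁻¹ * (1 + c) + (r 1)⁻¹ * 2), ?_⟩
    field_simp
    ring
  let b₀ : Fin 3 → ℝ := ![a₀, q, η * a₀]
  let b₁ : Fin 3 → ℝ := ![q, a₁, η * a₁]
  have hG := isVertexData_selfSimilarData (b₀ := b₀) (b₁ := b₁) hs hη rfl rfl rfl
  let a : List (Fin 3) → Fin 3 → ℝ := fun w =>
    match w with
    | [] => ![0, a₁, 0]
    | i :: w => ![harmonicData c r w ![0, a₀, 0], selfSimilarData c r η b₀ b₁ w,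
        harmonicData c r w 0] i
  have ha : IsVertexData a := by
    refine IsVertexData.of_children (fun i => Or.inl ?_) (fun j => ?_) fun i j => ?_
    · fin_cases i
      · exact hs.isVertexData _
      · exact hG
      · exact hs.isVertexData _
    · fin_cases j <;> simp [a, selfSimilarData, b₁]
    · fin_cases i <;> fin_cases j <;> simp [a, selfSimilarData, b₀]
  obtain ⟨f, hf, hfa⟩ := ha.exists_continuousOn hφ
  have hval : ∀ (m : ℕ) (j : Fin 3), j ≠ 2 →
      f (cellMap v (1 :: List.replicate m 2) (v j)) = η ^ m * α 2 1 j := by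
    intro m j hj
    rw [hfa]
    change selfSimilarData c r η b₀ b₁ (List.replicate m 2) j = _
    rw [selfSimilarData_replicate]
    obtain rfl | rfl : j = 0 ∨ j = 1 := by omega
    · simp [b₀, ha₀]
    · simp [b₁, ha₁]
  have hf0 : HasHarmonicValues v c r ![0, a₀, 0] fun x => f (sgMap v 0 x) := fun w i =>
    hfa (0 :: w) i
  have hf2 : HasHarmonicValues v c r 0 fun x => f (sgMap v 2 x) := fun w i => hfa (2 :: w) i
  have hv0 : f (v 0) = 0 := hfa [] 0
  have hv2 : f (v 2) = 0 := hfa [] 2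
  have hq02 : f (cellMap v [0] (v 2)) = 0 := hfa [0] 2
  have hq12 : f (cellMap v [1] (v 2)) = 0 := hfa [1] 2
  refine ⟨f, ⟨hval, hv0, hv2, hq02, hq12, ⟨by rwa [cellUnion_nil], fun m u hu => ?_⟩⟩, ?_⟩
  · have huv : ∀ (m : ℕ) (j : Fin 3), j ≠ 2 →
        u (cellMap v (1 :: List.replicate m 2) (v j)) = η ^ m * α 2 1 j := fun m j hj =>
      (hu (Or.inl ⟨m, j, hj, rfl⟩)).trans (hval m j hj)
    have u0 : u (v 0) = 0 := (hu (Or.inr (by simp))).trans hv0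
    have u2 : u (v 2) = 0 := (hu (Or.inr (by simp))).trans hv2
    have u02 : u (sgMap v 0 (v 2)) = 0 :=
      (hu (Or.inr (by simp [cellMap_cons]))).trans hq02
    have u12 : u (sgMap v 1 (v 2)) = 0 :=
      (hu (Or.inr (by simp [cellMap_cons]))).trans hq12
    have u01 : u (sgMap v 0 (v 1)) = a₀ := by
      rw [sgMap_comm]; simpa [cellMap] using huv 0 0 (by decide)
    rw [localEnergy_nil, localEnergy_nil]
    cases m with
    | zero =>
      have u1 : u (v 1) = a₁ := by simpa [cellMap, sgMap_self] using huv 0 1 (by decide)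
      have f1 : f (v 1) = a₁ := hfa [] 1
      rw [energy_zero, energy_zero]
      refine le_of_eq (congrArg _ (funext fun i => ?_))
      fin_cases i
      · exact hv0.trans u0.symm
      · exact f1.trans u1.symm
      · exact hv2.trans u2.symm
    | succ m =>
      rw [energy_succ, energy_succ]
      refine Finset.sum_le_sum fun i _ =>
        mul_le_mul_of_nonneg_left ?_ (inv_nonneg.2 (hs.r_pos i).le)
      fin_cases i
      · refine (hf0.energy_eq hs m).le.trans
          (le_trans ?_ ((hs.isBilateralStructure hφ).baseEnergy_le_energy m _))
        simp [baseEnergy, sgMap_self, u0, u01, u02]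
      · refine energy_selfSimilar_le (b₀ := b₀) (b₁ := b₁) hφ hs rfl rfl rfl hq m 1 _ _
          (fun w i => (hfa (1 :: w) i).trans (one_mul _).symm) fun k j => ?_
        by_cases hj : j = 2
        · rw [hj, cellMap_replicate_self]; simpa using u12
        · refine (huv k j hj).trans ?_
          obtain rfl | rfl : j = 0 ∨ j = 1 := by omega
          · simp [b₀, ha₀]
          · simp [b₁, ha₁]
      · refine (hf2.energy_eq hs m).le.trans ?_
        refine le_trans ?_ (energy_nonneg v hc.le hs.r_pos m _)
        simp [baseEnergy]
  · intro w i
    refine (hf2 w i).trans ?_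
    rw [harmonicData_zero]; rfl

lemma IsExampleFunction.unique (hφ : IsBarycentric v φ) (hs : IsRenormSolution c r)
    {f f' : Plane → ℝ} (hf : IsExampleFunction v c r α η f)
    (hf' : IsExampleFunction v c r α η f') :
    (∀ w i, f (cellMap v w (v i)) = f' (cellMap v w (v i))) ∧ EqOn f f' (gasket v) := by
  have key := (hs.isBilateralStructure hφ).eq_of_isHarmonicOn hf.harmonic hf'.harmonic (by
    rintro p (⟨m, j, hj, rfl⟩ | hp)
    · rw [hf.value m j hj, hf'.value m j hj]
    · rcases hp with rfl | rfl | rfl | rfl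
      · rw [hf.value_v1, hf'.value_v1]
      · rw [hf.value_v3, hf'.value_v3]
      · rw [hf.value_F1v3, hf'.value_F1v3]
      · rw [hf.value_F2v3, hf'.value_F2v3]) (by
    intro w hw
    rw [Finset.mem_singleton.1 hw]
    exact ⟨0, Or.inr (Or.inl rfl)⟩)
  rw [cellUnion_nil] at key
  exact ⟨key.1 [] (by simp), key.2⟩

/-- By uniqueness it is enough that the constructed example vanishes on `F_3 K`: all three corners
of that cell are nodes with value `0`. -/
lemma IsExampleFunction.eq_zero (hφ : IsBarycentric v φ) (hs : IsRenormSolution c r)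
    (hη : |η| < 1) {f : Plane → ℝ} (hf : IsExampleFunction v c r α η f) (w : List (Fin 3))
    (i : Fin 3) : f (cellMap v (2 :: w) (v i)) = 0 := by
  obtain ⟨f', hf', h0⟩ := exists_isExampleFunction (α := α) hφ hs hη
  rw [(hf.unique hφ hs hf').1, h0]

end Example

/-! ### Derivatives at the junction point -/

section Derivatives

variable {v : Fin 3 → Plane} {c : ℝ} {r : Fin 3 → ℝ} {lam : Fin 3 → Fin 3 → ℝ}
  {β : Fin 3 → Fin 3 → Fin 3 → ℝ}

lemma dotProduct_harmonicData_replicate {j : Fin 3} {b : Fin 3 → ℝ} {l : ℝ}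
    (h : Matrix.vecMul b (transitionMatrix c r j) = l • b) (m : ℕ) (t : Fin 3 → ℝ) :
    b ⬝ᵥ harmonicData c r (List.replicate m j) t = l ^ m * b ⬝ᵥ t := by
  induction m generalizing t with
  | zero => simp
  | succ m ih =>
    rw [List.replicate_succ, harmonicData_cons, ih, Matrix.dotProduct_mulVec, h, smul_dotProduct,
      smul_eq_mul, pow_succ, mul_assoc]

/-- For harmonic functions the sequence defining the derivative is constant, since each step
multiplies the pairing with `β j k` by exactly `lam j k`. -/
lemma HasHarmonicValues.hasVertexDeriv_iff {i j k : Fin 3} {t : Fin 3 → ℝ} {T : Plane → ℝ}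
    (hT : HasHarmonicValues v c r t fun x => T (sgMap v i x))
    (h : Matrix.vecMul (β j k) (transitionMatrix c r j) = lam j k • β j k)
    (hl : lam j k ≠ 0) {x : ℝ} :
    HasVertexDeriv v r lam β T [i] j k x ↔ x = (r i)⁻¹ * β j k ⬝ᵥ t := by
  have e : ∀ m : ℕ, (cellRatio r [i])⁻¹ * (lam j k ^ m)⁻¹ *
      ∑ l, β j k l * T (cellMap v ([i] ++ List.replicate m j) (v l)) = (r i)⁻¹ * β j k ⬝ᵥ t := by
    intro m
    have e1 : ∑ l, β j k l * T (cellMap v ([i] ++ List.replicate m j) (v l)) =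
        lam j k ^ m * β j k ⬝ᵥ t := by
      rw [← dotProduct_harmonicData_replicate h]
      exact Finset.sum_congr rfl fun l _ => congrArg _ (hT (List.replicate m j) l)
    rw [e1]
    simp [cellRatio]
    field_simp
  simp only [HasVertexDeriv, e]
  exact ⟨fun h => tendsto_nhds_unique h tendsto_const_nhds, fun h => h ▸ tendsto_const_nhds⟩

end Derivatives

/-! ### Weak tangent of the example and the main theorem -/

section Main

variable {v : Fin 3 → Plane} {φ : Fin 3 → Plane → ℝ} {c : ℝ} {r : Fin 3 → ℝ} {d g : ℝ}
  {M : Fin 3 → Matrix (Fin 3) (Fin 3) ℝ} {lam : Fin 3 → Fin 3 → ℝ}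
  {β α : Fin 3 → Fin 3 → Fin 3 → ℝ} {η : ℝ} {f : Plane → ℝ}

lemma IsExampleFunction.hasVertexDeriv (hf : IsExampleFunction v c r α η f)
    (hφ : IsBarycentric v φ) (hs : IsRenormSolution c r)
    (hE : IsSymmetricEigenData c r d g lam β α 2) (hη0 : 0 < η) (hη1 : η < r 1) {k : Fin 3}
    (hk : k ≠ 0) :
    HasVertexDeriv v r lam β f [1] 2 k 0 ∧ HasVertexDeriv v r lam β f [2] 1 k 0 := by
  have hr1 := hs.r_lt_one 1
  have hr0 := hs.r_pos 1
  constructor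
  · have hval : ∀ m l, f (cellMap v ([1] ++ List.replicate m 2) (v l)) = η ^ m * α 2 1 l := by
      intro m l
      by_cases hl : l = 2
      -- The eigenvector vanishes at the corner over `x`, which matches `f(x) = 0`; so the values of
      -- `f` on the whole boundary of the cell form `η ^ m` times the eigenvector.
      · have h2 : α 2 1 2 = 0 := by rw [hE.normal]; simp [normalVec]
        rw [hl, cellMap_append, cellMap_replicate_self, hf.value_F2v3, h2, mul_zero]
      · exact hf.value m l hl
    have hsum : ∀ m : ℕ, ∑ l, β 2 k l * f (cellMap v ([1] ++ List.replicate m 2) (v l)) =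
        η ^ m * β 2 k ⬝ᵥ α 2 1 := by
      intro m
      simp only [hval, dotProduct, Finset.mul_sum]
      exact Finset.sum_congr rfl fun l _ => by ring
    simp only [HasVertexDeriv, hsum]
    obtain rfl | rfl : k = 1 ∨ k = 2 := by omega
    · rw [hE.lam_one]
      have hlt : η / r 1 < 1 := (div_lt_one hr0).2 hη1
      have := (tendsto_pow_atTop_nhds_zero_of_lt_one (by positivity) hlt).const_mul
        ((cellRatio r [1])⁻¹ * β 2 1 ⬝ᵥ α 2 1)
      rw [mul_zero] at this
      refine this.congr fun m => ?_
      rw [div_pow]; ring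
    · have h0 : β 2 2 ⬝ᵥ α 2 1 = 0 := by
        rw [hE.normal, dotProduct_smul, hE.two_normal, smul_zero]
      simp [h0]
  · have hval : ∀ m l, f (cellMap v ([2] ++ List.replicate m 1) (v l)) = 0 := fun m l =>
      hf.eq_zero hφ hs (by rw [abs_of_pos hη0]; linarith) (List.replicate m 1) l
    simp only [HasVertexDeriv, hval, mul_zero, Finset.sum_const_zero, tendsto_const_nhds]

lemma isWeakTangent_zero (hs : IsRenormSolution c r)
    (h0 : f (cellMap v [1] (v 2)) = 0)
    (hd : ∀ k, k ≠ 0 → HasVertexDeriv v r lam β f [1] 2 k 0 ∧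
      HasVertexDeriv v r lam β f [2] 1 k 0) :
    IsWeakTangent v c r lam β f [] 1 2 fun _ => 0 := by
  refine ⟨⟨continuousOn_const, fun m u _ => ?_⟩, h0.symm, fun k hk => ?_⟩
  · refine le_trans (le_of_eq ?_) (localEnergy_nonneg v hs.c_pos.le hs.r_pos _ m u)
    simp [localEnergy, energy, baseEnergy]
  · exact ⟨⟨0, (hd k hk).1, by simp [HasVertexDeriv]⟩, ⟨0, (hd k hk).2, by simp [HasVertexDeriv]⟩⟩

lemma HasVertexDeriv.unique {w : List (Fin 3)} {j k : Fin 3} {x y : ℝ}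
    (hx : HasVertexDeriv v r lam β f w j k x) (hy : HasVertexDeriv v r lam β f w j k y) : x = y :=
  tendsto_nhds_unique hx hy

lemma IsWeakTangent.eqOn_zero {T : Plane → ℝ} (hT : IsWeakTangent v c r lam β f [] 1 2 T)
    (hφ : IsBarycentric v φ) (hs : IsRenormSolution c r) (hp : IsRenormParam c r d g)
    (hE : ∀ j, j ≠ 0 → IsSymmetricEigenData c r d g lam β α j)
    (hleft : ∀ j k, Matrix.vecMul (β j k) (transitionMatrix c r j) = lam j k • β j k)
    (hlam : ∀ j k, lam j k ≠ 0)
    (h0 : f (cellMap v [1] (v 2)) = 0)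
    (hd : ∀ k, k ≠ 0 → HasVertexDeriv v r lam β f [1] 2 k 0 ∧
      HasVertexDeriv v r lam β f [2] 1 k 0) :
    EqOn T (fun _ => 0) (nbhd v [] 1 2 0) := by
  obtain ⟨hh, hx, hder⟩ := hT
  obtain ⟨ξ, P, Q, Q', h1, h2⟩ := hh.nbhd_eigenComb hφ hs hp
  have hξ : ξ = 0 := by
    have := h1 [] 2
    rw [harmonicData_nil, eigenComb_self (by decide)] at this
    exact this.symm.trans (hx.trans h0)
  subst hξ
  have hz1 : ∀ k, k ≠ 0 → β 2 k ⬝ᵥ eigenComb c d g 2 0 P Q = 0 := by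
    intro k hk
    obtain ⟨x, hxf, hxT⟩ := (hder k hk).1
    obtain rfl : x = 0 := hxf.unique (hd k hk).1
    have := (h1.hasVertexDeriv_iff (hleft 2 k) (hlam 2 k)).1 hxT
    exact (mul_eq_zero.1 this.symm).resolve_left (inv_ne_zero (hs.r_pos 1).ne')
  have hz2 : ∀ k, k ≠ 0 → β 1 k ⬝ᵥ eigenComb c d g 1 0 (-P) Q' = 0 := by
    intro k hk
    obtain ⟨x, hxf, hxT⟩ := (hder k hk).2
    obtain rfl : x = 0 := hxf.unique (hd k hk).2
    have := (h2.hasVertexDeriv_iff (hleft 1 k) (hlam 1 k)).1 hxT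
    exact (mul_eq_zero.1 this.symm).resolve_left (inv_ne_zero (hs.r_pos 2).ne')
  have E2 := hE 2 (by decide)
  have E1 := hE 1 (by decide)
  -- Biorthogonality separates the coefficients: the normal derivative sees only `P`, and the other
  -- derivative on each side sees only `Q` or `Q'` respectively.
  have hP : P = 0 := by
    have := hz1 1 (by decide)
    simp only [eigenComb, zero_smul, zero_add, dotProduct_add, dotProduct_smul, smul_eq_mul,
      E2.one_tangential, mul_zero, add_zero] at this
    exact (mul_eq_zero.1 this).resolve_right E2.one_normal
  have hQ : Q = 0 := by
    have := hz1 2 (by decide)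
    simp only [eigenComb, zero_smul, zero_add, dotProduct_add, dotProduct_smul, smul_eq_mul,
      E2.two_normal, mul_zero, zero_add] at this
    exact (mul_eq_zero.1 this).resolve_right E2.two_tangential
  have hQ' : Q' = 0 := by
    have := hz2 2 (by decide)
    simp only [eigenComb, zero_smul, zero_add, dotProduct_add, dotProduct_smul, smul_eq_mul,
      E1.two_normal, mul_zero, zero_add] at this
    exact (mul_eq_zero.1 this).resolve_right E1.two_tangential
  subst hP hQ hQ'
  have hz : ∀ j, eigenComb c d g j 0 0 0 = 0 := fun j => by simp [eigenComb]
  rw [neg_zero, hz] at h2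
  rw [hz] at h1
  have hzero : HasHarmonicValues v c r 0 fun _ => 0 := fun w i => by
    rw [harmonicData_zero]; rfl
  exact eqOn_nbhd hh.1 continuousOn_const h1 h2 hzero hzero

end Main

theorem mainTheorem7 :
    ∃ ε : ℝ, 0 < ε ∧ ∀ v : Fin 3 → Plane, IsEquilateral v →
      (∀ s : ℝ, |s - 1| < ε →
        ∃ (c : ℝ) (r : Fin 3 → ℝ), IsBilateralStructure v c r ∧ r 1 / r 0 = s) ∧
      ∀ (c : ℝ) (r : Fin 3 → ℝ), IsBilateralStructure v c r →
        r 1 / r 0 ≠ 1 → |r 1 / r 0 - 1| < ε →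
        (∃ M lam β α, IsEigenData v c r M lam β α) ∧
        ∀ M lam β α, IsEigenData v c r M lam β α →
          (|lam 1 2| = |lam 2 2| ∧ |lam 1 2| < lam 1 1 ∧ lam 1 1 = lam 2 1) ∧
          ∀ η : ℝ, |lam 1 2| < η → η < lam 1 1 →
            (∃ f, IsExampleFunction v c r α η f ∧
              ∀ g, IsExampleFunction v c r α η g → EqOn g f (gasket v)) ∧
            ∀ f, IsExampleFunction v c r α η f →
              IsDifferentiableAtJunction v r lam β f [] 1 2 ∧
              (∀ k, k ≠ 0 → HasVertexDeriv v r lam β f [1] 2 k 0 ∧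
                HasVertexDeriv v r lam β f [2] 1 k 0) ∧
              IsWeakTangent v c r lam β f [] 1 2 (fun _ => 0) ∧
              (∀ T, IsWeakTangent v c r lam β f [] 1 2 T →
                EqOn T (fun _ => 0) (nbhd v [] 1 2 0)) ∧
              (∀ m, ∃ h, IsApproximant v c r f [] 1 2 m h ∧
                ∀ h', IsApproximant v c r f [] 1 2 m h' → EqOn h' h (nbhd v [] 1 2 0)) ∧
              ∀ h : ℕ → Plane → ℝ, (∀ m, IsApproximant v c r f [] 1 2 m (h m)) →
                Tendsto (fun m => ⨆ y : nbhd v [] 1 2 0, |h m y|) atTop atTop ∧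
                ¬ TendstoUniformlyOn h (fun _ => 0) atTop (nbhd v [] 1 2 0) ∧
                ¬ ∀ y ∈ nbhd v [] 1 2 0, Tendsto (fun m => h m y) atTop (𝓝 0) := by
  refine ⟨1 / 4, by norm_num, fun v hv => ?_⟩
  obtain ⟨φ, hφ⟩ := hv.exists_barycentric
  refine ⟨fun s hs => ?_, fun c r hb hne hlt => ?_⟩
  · obtain ⟨c, r, h, hsr⟩ := exists_isRenormSolution hs
    exact ⟨c, r, h.isBilateralStructure hφ, hsr⟩
  have hs := hb.isRenormSolution hφ
  obtain ⟨d, g, hp⟩ := hs.exists_param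
  have h3 := hs.one_third_lt hlt
  refine ⟨hp.exists_isEigenData hφ hs h3, fun M lam β α hE => ?_⟩
  have hEj := fun j hj => hE.isSymmetricEigenData hφ hs hp h3 (j := j) hj
  have E1 := hEj 1 (by decide)
  have E2 := hEj 2 (by decide)
  have hr1 := hp.r_lt_one 1
  have hr0 := hs.r_pos 1
  have hleft := hE.left_eigen
  rw [hE.eq_transitionMatrix hφ hs] at hleft
  have habs : |lam 1 2| = (1 - r 1) / 2 := by rw [E1.lam_two, abs_of_pos (by linarith)]
  refine ⟨⟨by rw [E1.lam_two, E2.lam_two], by rw [habs, E1.lam_one]; linarith,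
    by rw [E1.lam_one, E2.lam_one]⟩, fun η hη1 hη2 => ?_⟩
  rw [habs] at hη1
  rw [E1.lam_one] at hη2
  have hη0 : 0 < η := by linarith
  have hηa : |η| < 1 := by rw [abs_of_pos hη0]; linarith
  refine ⟨?_, fun f hf => ?_⟩
  · obtain ⟨f, hf, -⟩ := exists_isExampleFunction (α := α) hφ hs hηa
    exact ⟨f, hf, fun g hg => (hg.unique hφ hs hf).2⟩
  have hd := fun k hk => hf.hasVertexDeriv hφ hs E2 hη0 hη2 (k := k) hk
  set κ₀ := -(g + c * d)⁻¹ with hκ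
  have hκ0 : κ₀ ≠ 0 := by
    have hc := hp.c_pos
    have hd := hp.d_pos
    have hg := hp.g_pos
    exact neg_ne_zero.2 (inv_ne_zero (by positivity))
  have hf1 : ∀ m l, l ≠ 2 → f (cellMap v (1 :: List.replicate m 2) (v l)) =
      η ^ m * κ₀ * normalVec d g 2 l := by
    intro m l hl
    rw [hf.value m l hl, E2.normal, ← hκ, Pi.smul_apply, smul_eq_mul, mul_assoc]
  have hf2 : ∀ m l, l ≠ 1 → f (cellMap v (2 :: List.replicate m 1) (v l)) = 0 := fun m l _ =>
    hf.eq_zero hφ hs hηa _ l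
  refine ⟨⟨⟨0, ?_⟩, 0, 0, fun k hk => (hd k hk).1, fun k hk => (hd k hk).2, by simp⟩, hd,
    isWeakTangent_zero hs hf.value_F2v3 hd,
    fun T hT => hT.eqOn_zero hφ hs hp hEj hleft hE.lam_ne_zero hf.value_F2v3 hd,
    fun m => ?_, fun h hh => ?_⟩
  · have := hf.harmonic.1
    rw [cellUnion_nil] at this
    exact this.mono nbhd_subset_gasket
  · obtain ⟨h, hh⟩ := hp.exists_approximant hφ hs (hf1 m) (hf2 m)
    refine ⟨h, hh, fun h' hh' => ?_⟩
    obtain ⟨e1, e2⟩ := hh.values hφ hs hp (hf1 m) (hf2 m)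
    obtain ⟨e1', e2'⟩ := hh'.values hφ hs hp (hf1 m) (hf2 m)
    exact eqOn_nbhd hh'.1.1 hh.1.1 e1' e2' e1 e2
  -- Divergence at this single point, the vertex `v_2`, refutes pointwise and uniform convergence
  -- and makes the suprema unbounded.
  · have hy : sgMap v 1 (v 1) ∈ nbhd v [] 1 2 0 := (vertex_mem_nbhd [] 1).1
    have hval : ∀ m, h m (sgMap v 1 (v 1)) = approximantData c r d g (η ^ m * κ₀) m 2 1 1 :=
      fun m => ((hh m).values hφ hs hp (hf1 m) (hf2 m)).1 [] 1
    have hgrow : Tendsto (fun m => |h m (sgMap v 1 (v 1))|) atTop atTop := by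
      simp only [hval]
      exact tendsto_approximantData hp hs (hp.g_ne_d hs hne) hκ0 hη1 hη2
    have hnot : ¬ Tendsto (fun m => h m (sgMap v 1 (v 1))) atTop (𝓝 0) := fun ht =>
      not_tendsto_nhds_of_tendsto_atTop hgrow _ ht.abs
    refine ⟨tendsto_atTop_mono (fun m => ?_) hgrow, fun hu => hnot (hu.tendsto_at hy),
      fun ht => hnot (ht _ hy)⟩
    -- Boundedness has to be known, because the supremum of an unbounded real family defaults to
    -- `0`.
    have hcomp : IsCompact (nbhd v [] 1 2 0) := by
      refine (nbhdCells [] 1 2 0).isCompact_biUnion fun w _ => ?_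
      exact (gasket_spec v).2.1.image (continuous_cellMap v w)
    have hbdd : BddAbove (range fun y : nbhd v [] 1 2 0 => |h m y|) := by
      have := (hcomp.image_of_continuousOn (hh m).1.1.abs).bddAbove
      rwa [image_eq_range] at this
    exact le_ciSup hbdd ⟨_, hy⟩
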